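/- Fix a prime $p>2$ and a group $\{1,\sigma\}$ of order $2$. For a topological group $G$ with a continuous action of $\sigma$ put $G^+=\{a\in G\mid {}^\sigma a=a\}$ and $G^-=\{a\in G\mid {}^\sigma a=a^{-1}\}$; a $\sigma$-isomorphism is a $\sigma$-equivariant isomorphism of topological groups, and $D_i(G)$ denotes the $i$-th closed dimension subgroup (Zassenhaus filtration with respect to $p$). For $n\ge0$ let $F_n$ be the free pro-$p$-group on $x_1,\dots,x_n$, with the action ${}^\sigma x_i=x_i^{-1}$. For $r=(r_1,\dots,r_n)\in(F_n^-)^n$ let $N_r$ be the closed normal subgroup of $F_n$ generated by all conjugates of $r_1,\dots,r_n$, and let $\mathrm{Sch}$ be the set of all groups $F_n/N_r$ (for all $n\ge 0$ and all $r$) up to $\sigma$-isomorphism, with the topology generated by the sets $$U_{i,G}=\{[H]\in\mathrm{Sch}\mid H/D_i(H)\cong G/D_i(G)\ \text{$\sigma$-isomorphic}\}\qquad(i\ge2,\ [G]\in\mathrm{Sch}).$$ Let $\mu_{F_n^-}$ be the Haar measure on $F_n^-$, i.e. the image of the normalized Haar measure of $F_n$ under the projection to the second factor of $F_n^+\times F_n^-\cong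 F_n$, $(a,b)\mapsto ab$. Let $\mu_n$ be the image of the product measure $\mu_{F_n^-}^{\otimes n}$ under $\Theta_n\colon(F_n^-)^n\to\mathrm{Sch}$, $r\mapsto[F_n/N_r]$, and let $\mu_\infty$ be the limit of the measures $\mu_n$ for $n\to\infty$: the probability measure on the Borel sets of $\mathrm{Sch}$ with $\mu_\infty(S)=\lim_{n\to\infty}\mu_n(S)$ for every Borel set $S$. Put $C_\infty=\prod_{i\ge1}(1-p^{-i})$, and for $[G]\in\mathrm{Sch}$ let $G_{\rm ab}$ be the quotient of $G$ by the closure of its commutator subgroup. Then the limit measure $\mu_\infty$ exists, and for every finite abelian $p$-group $A$ the set $\{[G]\in\mathrm{Sch}\mid G_{\rm ab}\cong A\}$ is open and closed in $\mathrm{Sch}$ and has measure $$\mu_\infty\bigl(\{[G]\in\mathrm{Sch}\mid G_{\rm ab}\cong A\}\bigr)\ =\ \frac{C_\infty}{|\mathrm{Aut}(A)|},$$ which is the value that the Cohen–Lenstra heuristic for imaginary quadratic fields assigns to $A$. -/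

import Mathlib

open MeasureTheory Filter Topology

/-! ### Topological groups with a continuous action of a group `{1, σ}` of order two -/

/-- A continuous action of `{1, σ}` on a topological group, given by the involution `σ`. -/
class SigmaGroup (G : Type*) [Group G] [TopologicalSpace G] where
  /-- the action of `σ` -/
  sigma : G →* G
  sigma_sigma : ∀ x, sigma (sigma x) = x
  continuous_sigma : Continuous sigma

namespace SigmaGroup

/-- The even part `G⁺` of `G`. -/
abbrev EvenPart (G : Type*) [Group G] [TopologicalSpace G] [SigmaGroup G] : Type _ :=
  {a : G // sigma a = a}

/-- The odd part `G⁻` of `G`. -/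
abbrev OddPart (G : Type*) [Group G] [TopologicalSpace G] [SigmaGroup G] : Type _ :=
  {a : G // sigma a = a⁻¹}

instance (G : Type*) [Group G] [TopologicalSpace G] [SigmaGroup G] : Nonempty (EvenPart G) :=
  ⟨⟨1, map_one _⟩⟩

instance (G : Type*) [Group G] [TopologicalSpace G] [SigmaGroup G] : Nonempty (OddPart G) :=
  ⟨⟨1, by simp⟩⟩

/-- The action of `σ` induced on the quotient by a `σ`-invariant normal subgroup. -/
abbrev quotient {G : Type*} [Group G] [TopologicalSpace G] [SigmaGroup G]
    (N : Subgroup G) [N.Normal] (hN : N ≤ N.comap (sigma : G →* G)) : SigmaGroup (G ⧸ N) where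
  sigma := QuotientGroup.map N N sigma hN
  sigma_sigma := by
    intro x
    induction x using QuotientGroup.induction_on with
    | H x => simp [sigma_sigma]
  continuous_sigma := by
    refine continuous_quot_lift _ ?_
    exact QuotientGroup.continuous_mk.comp continuous_sigma

end SigmaGroup

/-- A `σ`-isomorphism: a `σ`-equivariant isomorphism of topological groups. -/
structure SigmaIso (G H : Type*) [Group G] [TopologicalSpace G] [SigmaGroup G]
    [Group H] [TopologicalSpace H] [SigmaGroup H] extends G ≃ₜ* H where
  map_sigma : ∀ x : G,
    toContinuousMulEquiv (SigmaGroup.sigma x) = SigmaGroup.sigma (toContinuousMulEquiv x)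

namespace SigmaIso

variable {G H K : Type*} [Group G] [TopologicalSpace G] [SigmaGroup G]
  [Group H] [TopologicalSpace H] [SigmaGroup H] [Group K] [TopologicalSpace K] [SigmaGroup K]

/-- The identity. -/
def refl (G : Type*) [Group G] [TopologicalSpace G] [SigmaGroup G] : SigmaIso G G where
  toContinuousMulEquiv := ContinuousMulEquiv.refl G
  map_sigma _ := rfl

/-- The inverse of a `σ`-isomorphism. -/
def symm (e : SigmaIso G H) : SigmaIso H G where
  toContinuousMulEquiv := e.toContinuousMulEquiv.symm
  map_sigma x := by
    apply e.toContinuousMulEquiv.injective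
    rw [e.map_sigma]
    simp

/-- The composition of `σ`-isomorphisms. -/
def trans (e : SigmaIso G H) (f : SigmaIso H K) : SigmaIso G K where
  toContinuousMulEquiv := e.toContinuousMulEquiv.trans f.toContinuousMulEquiv
  map_sigma x := by
    simp [e.map_sigma, f.map_sigma]

end SigmaIso

/-! ### The Zassenhaus filtration -/

/-- The `n`-th (closed) dimension subgroup `D_n(G)`: `D_1(G) = G`, and for `n > 1` the closed
subgroup generated by the `p`-th powers of elements of `D_{⌈n/p⌉}(G)` and by all commutator
subgroups `[D_i(G), D_{n-i}(G)]` with `0 < i < n`. (By convention `D_0(G) = G`.) -/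
def zassenhaus (p : ℕ) [hp : Fact p.Prime] (G : Type*) [Group G] [TopologicalSpace G]
    [IsTopologicalGroup G] (n : ℕ) : Subgroup G :=
  if _hn : n ≤ 1 then ⊤ else
    (Subgroup.closure {y | ∃ x ∈ zassenhaus p G ((n + p - 1) / p), x ^ p = y} ⊔
      ⨆ i : {i : ℕ // 0 < i ∧ i < n},
        ⁅zassenhaus p G i.1, zassenhaus p G (n - i.1)⁆).topologicalClosure
termination_by n
decreasing_by
  · have h2 := hp.out.two_le
    rw [Nat.div_lt_iff_lt_mul (by omega)]
    have h3 : n * 2 ≤ n * p := Nat.mul_le_mul_left n h2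
    obtain ⟨q, rfl⟩ : ∃ q, p = q + 2 := ⟨p - 2, by omega⟩
    obtain ⟨m, rfl⟩ : ∃ m, n = m + 2 := ⟨n - 2, by omega⟩
    have : (m + 2) * (q + 2) = m * q + 2 * m + 2 * q + 4 := by ring
    omega
  · exact i.2.2
  · have := i.2
    omega

/-- Continuous homomorphisms are compatible with the Zassenhaus filtration. -/
theorem zassenhaus_le_comap (p : ℕ) [Fact p.Prime] {G H : Type*} [Group G] [TopologicalSpace G]
    [IsTopologicalGroup G] [Group H] [TopologicalSpace H] [IsTopologicalGroup H]
    (f : G →* H) (hf : Continuous f) (n : ℕ) :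
    zassenhaus p G n ≤ (zassenhaus p H n).comap f := by
  induction n using Nat.strong_induction_on with
  | _ n ih =>
    by_cases hn : n ≤ 1
    · rw [zassenhaus.eq_def p H n, dif_pos hn]
      simp
    have hlt : (n + p - 1) / p < n := by
      have h2 := (Fact.out : p.Prime).two_le
      rw [Nat.div_lt_iff_lt_mul (by omega)]
      obtain ⟨q, rfl⟩ : ∃ q, p = q + 2 := ⟨p - 2, by omega⟩
      obtain ⟨m, rfl⟩ : ∃ m, n = m + 2 := ⟨n - 2, by omega⟩
      have : (m + 2) * (q + 2) = m * q + 2 * m + 2 * q + 4 := by ring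
      omega
    rw [zassenhaus.eq_def p G n, dif_neg hn]
    refine Subgroup.topologicalClosure_minimal _ (sup_le ?_ (iSup_le ?_)) ?_
    · rw [Subgroup.closure_le]
      rintro _ ⟨x, hx, rfl⟩
      rw [zassenhaus.eq_def p H n, dif_neg hn]
      refine Subgroup.le_topologicalClosure _ (Subgroup.mem_sup_left (Subgroup.subset_closure ?_))
      exact ⟨f x, ih _ hlt hx, (map_pow f x p).symm⟩
    · intro i
      rw [← Subgroup.map_le_iff_le_comap, Subgroup.map_commutator]
      rw [zassenhaus.eq_def p H n, dif_neg hn]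
      refine le_trans ?_ (Subgroup.le_topologicalClosure _)
      refine le_trans ?_ le_sup_right
      refine le_trans ?_ (le_iSup _ i)
      refine Subgroup.commutator_mono ?_ ?_
      · exact Subgroup.map_le_iff_le_comap.2 (ih _ i.2.2)
      · exact Subgroup.map_le_iff_le_comap.2 (ih _ (by have := i.2; omega))
    · have hc : IsClosed (zassenhaus p H n : Set H) := by
        rw [zassenhaus.eq_def p H n, dif_neg hn]
        exact Subgroup.isClosed_topologicalClosure _
      exact hc.preimage hf

instance zassenhaus_normal (p : ℕ) [Fact p.Prime] (G : Type*) [Group G] [TopologicalSpace G]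
    [IsTopologicalGroup G] (n : ℕ) : (zassenhaus p G n).Normal where
  conj_mem x hx g := by
    have hc : Continuous (MulAut.conj g).toMonoidHom := by
      change Continuous fun x : G => g * x * g⁻¹
      fun_prop
    exact zassenhaus_le_comap p (MulAut.conj g).toMonoidHom hc n hx

instance zassenhausQuotient_sigmaGroup (p : ℕ) [Fact p.Prime] (G : Type*) [Group G]
    [TopologicalSpace G] [IsTopologicalGroup G] [SigmaGroup G] (n : ℕ) :
    SigmaGroup (G ⧸ zassenhaus p G n) :=
  SigmaGroup.quotient _ (zassenhaus_le_comap p _ SigmaGroup.continuous_sigma n)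

/-! ### The free pro-`p`-group on `n` odd generators -/

/-- Normal subgroups of `p`-power index of the (abstract) free group of rank `n`. -/
def PIndex (p n : ℕ) : Type :=
  {N : Subgroup (FreeGroup (Fin n)) // N.Normal ∧ ∃ k, N.index = p ^ k}

instance {p n : ℕ} (N : PIndex p n) : N.1.Normal := N.2.1

/-- The finite `p`-group quotient attached to `N`, with the discrete topology. -/
def PQuot {p n : ℕ} (N : PIndex p n) : Type := FreeGroup (Fin n) ⧸ N.1

instance {p n : ℕ} (N : PIndex p n) : Group (PQuot N) :=
  inferInstanceAs (Group (FreeGroup (Fin n) ⧸ N.1))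

instance {p n : ℕ} (N : PIndex p n) : TopologicalSpace (PQuot N) := ⊥

instance {p n : ℕ} (N : PIndex p n) : DiscreteTopology (PQuot N) := ⟨rfl⟩

/-- The homomorphism `PQuot M → PQuot N` induced by an endomorphism of the free group. -/
def PQuot.map {p n : ℕ} (M N : PIndex p n) (f : FreeGroup (Fin n) →* FreeGroup (Fin n))
    (h : M.1 ≤ N.1.comap f) : PQuot M →* PQuot N :=
  QuotientGroup.map M.1 N.1 f h

/-- The inverse limit of all finite `p`-group quotients of the free group of rank `n`, as the
subgroup of compatible families in the product. -/
def freeProPSubgroup (p n : ℕ) : Subgroup (∀ N : PIndex p n, PQuot N) where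
  carrier := {f | ∀ (M N : PIndex p n) (h : M.1 ≤ N.1),
    PQuot.map M N (MonoidHom.id _) (h.trans_eq (Subgroup.comap_id _).symm) (f M) = f N}
  one_mem' := by
    intro M N h
    simp
  mul_mem' := by
    intro a b ha hb M N h
    simp [ha M N h, hb M N h]
  inv_mem' := by
    intro a ha M N h
    simp [ha M N h]

/-- The free pro-`p`-group `F_n` of rank `n`: the pro-`p` completion of the free group on
`n` generators, with the inverse limit topology. -/
abbrev FreeProP (p n : ℕ) : Type := freeProPSubgroup p n

instance (p n : ℕ) [hp : Fact p.Prime] : CompactSpace (FreeProP p n) := by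
  have hfin : ∀ N : PIndex p n, Finite (PQuot N) := by
    intro N
    obtain ⟨k, hk⟩ := N.2.2
    apply Nat.finite_of_card_ne_zero
    change N.1.index ≠ 0
    rw [hk]
    exact pow_ne_zero _ hp.out.ne_zero
  have hclosed : IsClosed (freeProPSubgroup p n : Set (∀ N : PIndex p n, PQuot N)) := by
    have : (freeProPSubgroup p n : Set (∀ N : PIndex p n, PQuot N)) =
        ⋂ (M : PIndex p n) (N : PIndex p n) (h : M.1 ≤ N.1),
          {f | PQuot.map M N (MonoidHom.id _) (h.trans_eq (Subgroup.comap_id _).symm) (f M) = f N} := by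
      ext f
      simp only [Set.mem_iInter]
      rfl
    rw [this]
    refine isClosed_iInter fun M => isClosed_iInter fun N => isClosed_iInter fun h => ?_
    exact isClosed_eq (continuous_of_discreteTopology.comp (continuous_apply M))
      (continuous_apply N)
  exact isCompact_iff_compactSpace.1 hclosed.isCompact

instance (p n : ℕ) : MeasurableSpace (FreeProP p n) := borel _

instance (p n : ℕ) : BorelSpace (FreeProP p n) := ⟨rfl⟩

namespace FreeProP

/-- The generator `x_i` of `F_n`. -/
def gen (p : ℕ) {n : ℕ} (i : Fin n) : FreeProP p n :=
  ⟨fun N => (QuotientGroup.mk (FreeGroup.of i) : FreeGroup (Fin n) ⧸ N.1), fun _ _ _ => rfl⟩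

/-- The endomorphism of the free group that inverts every generator. -/
def invGen (n : ℕ) : FreeGroup (Fin n) →* FreeGroup (Fin n) :=
  FreeGroup.lift fun i => (FreeGroup.of i)⁻¹

theorem invGen_comp_invGen (n : ℕ) : (invGen n).comp (invGen n) = MonoidHom.id _ := by
  ext i
  simp [invGen]

theorem invGen_invGen {n : ℕ} (w : FreeGroup (Fin n)) : invGen n (invGen n w) = w :=
  DFunLike.congr_fun (invGen_comp_invGen n) w

/-- The preimage of `N` under `invGen`. -/
def comapIndex {p n : ℕ} (N : PIndex p n) : PIndex p n :=
  ⟨N.1.comap (invGen n), N.2.1.comap _, by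
    rw [Subgroup.index_comap_of_surjective _ fun w => ⟨invGen n w, invGen_invGen w⟩]
    exact N.2.2⟩

/-- The automorphism `σ` of `F_n` that inverts every generator. -/
def sigmaHom (p n : ℕ) : FreeProP p n →* FreeProP p n where
  toFun f := ⟨fun N => PQuot.map (comapIndex N) N (invGen n) le_rfl (f.1 (comapIndex N)), by
    intro M N h
    change PQuot.map M N (MonoidHom.id _) (h.trans_eq (Subgroup.comap_id _).symm)
      (PQuot.map (comapIndex M) M (invGen n) le_rfl (f.1 (comapIndex M))) =
      PQuot.map (comapIndex N) N (invGen n) le_rfl (f.1 (comapIndex N))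
    have h' : (comapIndex M).1 ≤ (comapIndex N).1 := Subgroup.comap_mono h
    rw [← f.2 (comapIndex M) (comapIndex N) h']
    generalize f.1 (comapIndex M) = y
    revert y
    refine fun y => Quotient.inductionOn' y fun w => ?_
    rfl⟩
  map_one' := by
    apply Subtype.ext
    funext N
    exact map_one _
  map_mul' a b := by
    apply Subtype.ext
    funext N
    exact map_mul _ _ _

instance (p n : ℕ) : SigmaGroup (FreeProP p n) where
  sigma := sigmaHom p n
  sigma_sigma f := by
    apply Subtype.ext
    funext N
    change PQuot.map (comapIndex N) N (invGen n) le_rfl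
      (PQuot.map (comapIndex (comapIndex N)) (comapIndex N) (invGen n) le_rfl
        (f.1 (comapIndex (comapIndex N)))) = f.1 N
    have h : (comapIndex (comapIndex N)).1 ≤ N.1 := by
      intro w hw
      have hw' : invGen n (invGen n w) ∈ N.1 := hw
      rwa [invGen_invGen] at hw'
    rw [← f.2 _ _ h]
    generalize f.1 (comapIndex (comapIndex N)) = y
    revert y
    refine fun y => Quotient.inductionOn' y fun w => ?_
    exact congrArg (fun v => (QuotientGroup.mk v : FreeGroup (Fin n) ⧸ N.1)) (invGen_invGen w)
  continuous_sigma := by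
    refine Continuous.subtype_mk (continuous_pi fun N => ?_) _
    exact continuous_of_discreteTopology.comp
      ((continuous_apply (comapIndex N)).comp continuous_subtype_val)

/-- The generators of `F_n` are odd. -/
theorem sigma_gen (p : ℕ) {n : ℕ} (i : Fin n) :
    SigmaGroup.sigma (gen p i) = (gen p i)⁻¹ := by
  apply Subtype.ext
  funext N
  exact congrArg (fun v => (QuotientGroup.mk v : FreeGroup (Fin n) ⧸ N.1))
    (by simp [invGen] : invGen n (FreeGroup.of i) = (FreeGroup.of i)⁻¹)

end FreeProP

open SigmaGroup

/-! ### Weak Schur `σ`-groups -/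

/-- Tuples of `n` odd relations in `F_n`. -/
abbrev OddTuple (p n : ℕ) : Type := Fin n → OddPart (FreeProP p n)

/-- The closed normal subgroup `N_r` of `F_n` generated by all conjugates of the `r_i`. -/
def relSubgroup {p n : ℕ} (r : OddTuple p n) : Subgroup (FreeProP p n) :=
  (Subgroup.normalClosure (Set.range fun i => (r i : FreeProP p n))).topologicalClosure

instance {p n : ℕ} (r : OddTuple p n) : (relSubgroup r).Normal :=
  Subgroup.is_normal_topologicalClosure _

theorem relSubgroup_le_comap {p n : ℕ} (r : OddTuple p n) :
    relSubgroup r ≤ (relSubgroup r).comap (sigma : FreeProP p n →* FreeProP p n) := by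
  refine Subgroup.topologicalClosure_minimal _ (Subgroup.normalClosure_le_normal ?_) ?_
  · rintro _ ⟨i, rfl⟩
    change sigma (r i : FreeProP p n) ∈ relSubgroup r
    rw [(r i).2]
    exact inv_mem (Subgroup.le_topologicalClosure _ (Subgroup.subset_normalClosure ⟨i, rfl⟩))
  · exact (Subgroup.isClosed_topologicalClosure _).preimage SigmaGroup.continuous_sigma

/-- The weak Schur `σ`-group `G_r = F_n / N_r`. -/
abbrev SchurGroup {p n : ℕ} (r : OddTuple p n) : Type := FreeProP p n ⧸ relSubgroup r

instance {p n : ℕ} (r : OddTuple p n) : SigmaGroup (SchurGroup r) :=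
  SigmaGroup.quotient _ (relSubgroup_le_comap r)

/-- Two presentations are equivalent if the groups that they define are `σ`-isomorphic. -/
instance schurSetoid (p : ℕ) : Setoid (Σ n : ℕ, OddTuple p n) where
  r a b := Nonempty (SigmaIso (SchurGroup a.2) (SchurGroup b.2))
  iseqv :=
    { refl := fun _ => ⟨SigmaIso.refl _⟩
      symm := fun ⟨e⟩ => ⟨e.symm⟩
      trans := fun ⟨e⟩ ⟨f⟩ => ⟨e.trans f⟩ }

/-- The set `Sch` of weak Schur `σ`-groups up to `σ`-isomorphism. -/
def Sch (p : ℕ) : Type := Quotient (schurSetoid p)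

/-- The map `Θ_n`, sending `r` to the class of `G_r`. -/
def Theta (p n : ℕ) (r : OddTuple p n) : Sch p := Quotient.mk (schurSetoid p) ⟨n, r⟩

/-- The set `U_{i,G}` of all `[H]` with `H/D_i(H) ≅ G/D_i(G)` as `σ`-groups, for `G = G_r`. -/
def schNhd (p : ℕ) [Fact p.Prime] (i : ℕ) {n : ℕ} (r : OddTuple p n) : Set (Sch p) :=
  {x | ∃ (m : ℕ) (s : OddTuple p m), Theta p m s = x ∧
    Nonempty (SigmaIso (SchurGroup s ⧸ zassenhaus p (SchurGroup s) i)
      (SchurGroup r ⧸ zassenhaus p (SchurGroup r) i))}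

/-- The topology on `Sch` generated by the sets `U_{i,G}` for `i ≥ 2`. -/
instance (p : ℕ) [Fact p.Prime] : TopologicalSpace (Sch p) :=
  TopologicalSpace.generateFrom
    {U | ∃ (i n : ℕ) (r : OddTuple p n), 2 ≤ i ∧ U = schNhd p i r}

instance (p : ℕ) [Fact p.Prime] : MeasurableSpace (Sch p) := borel _

instance (p : ℕ) [Fact p.Prime] : BorelSpace (Sch p) := ⟨rfl⟩

/-- The set of all `[G]` with `G_ab ≅ A`, where `G_ab` is the quotient of `G` by the closure of
its commutator subgroup. -/
def schAb (p : ℕ) (A : Type*) [Group A] : Set (Sch p) :=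
  {x | ∃ (n : ℕ) (r : OddTuple p n), Theta p n r = x ∧
    Nonempty (TopologicalAbelianization (SchurGroup r) ≃* A)}

/-! ### The measures -/

noncomputable section

/-- The projection `F_n → F_n⁻` to the second factor under the product map
`F_n⁺ × F_n⁻ → F_n`, which is a bijection for odd `p`. -/
def oddProj (p n : ℕ) (g : FreeProP p n) : OddPart (FreeProP p n) :=
  (Function.invFun
    (fun ab : EvenPart (FreeProP p n) × OddPart (FreeProP p n) =>
      (ab.1 : FreeProP p n) * (ab.2 : FreeProP p n)) g).2

/-- The Haar measure on `F_n⁻`: the image of the normalized Haar measure of `F_n` under the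
projection to the second factor of `F_n⁺ × F_n⁻ ≃ F_n`. -/
def oddHaar (p n : ℕ) [Fact p.Prime] : Measure (OddPart (FreeProP p n)) :=
  (Measure.haarMeasure (⊤ : TopologicalSpace.PositiveCompacts (FreeProP p n))).map (oddProj p n)

/-- The measure `μ_n` on `Sch`: the image under `Θ_n` of the product measure on `(F_n⁻)^n`. -/
def schMeasure (p n : ℕ) [Fact p.Prime] : Measure (Sch p) :=
  (Measure.pi fun _ : Fin n => oddHaar p n).map (Theta p n)

/-- `ν` is a probability measure on `Sch`, and `μ_n(S)` converges to `ν(S)` for every Borel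
set `S`. Such a `ν` is unique, since its values are limits. -/
structure IsSchLimit (p : ℕ) [Fact p.Prime] (ν : Measure (Sch p)) : Prop where
  isProbabilityMeasure : IsProbabilityMeasure ν
  tendsto : ∀ S : Set (Sch p), MeasurableSet S →
    Tendsto (fun n => schMeasure p n S) atTop (𝓝 (ν S))

open Classical in
/-- The limit `μ_∞` of the measures `μ_n` (zero, hence not a limit, if there is none). -/
def schMeasureInfty (p : ℕ) [Fact p.Prime] : Measure (Sch p) :=
  if h : ∃ ν, IsSchLimit p ν then h.choose else 0

/-- The constant `C_∞ = ∏_{i ≥ 1} (1 - p^{-i})`. -/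
def cInfty (p : ℕ) : ℝ := ∏' i : ℕ, (1 - ((p : ℝ) ^ (i + 1))⁻¹)

end

/-!
The limit measure is obtained from a comparison of `μ_{n+1}` with `μ_n`. Write `F_n` for the free
pro-`p`-group on `n` odd generators. If the first of the `n + 1` relations in `F_{n+1}` is nontrivial
modulo the Frattini subgroup, then by Burnside's basis theorem and the Hopfian property it belongs
to a basis of odd elements, so that killing it leaves `F_n` with its action of `σ`
(`FreeProP.exists_hom_ker_eq_of_abMap_ne_one`). The remaining `n` relations then become independent
Haar-distributed elements of `F_n⁻`, and the group that is presented does not change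
(`Theta_cons_eq`). The exceptional event has probability `p^{-(n+1)}`, whence
`μ_{n+1} ≥ (1 - p^{-(n+1)}) μ_n` on Borel sets (`mul_schMeasure_le`). Divided by the partial products
of `C_∞`, the measures `μ_n` therefore increase, and since `C_∞ > 0` they converge on every Borel
set to a probability measure (`exists_isSchLimit`). That the `μ_n` are measures on the Borel sets at
all uses the continuity of `Θ_n` (`continuous_Theta`), which holds because the dimension subgroups
of `F_n` are open.

For the abelianization, let `p^k A = 0`. By Nakayama's lemma `G_ab ≅ A` is equivalent to
`G_ab / p^{k+1} ≅ A` (`nonempty_mulEquiv_iff_abModPow`), and the latter group depends only on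
`G / D_i(G)` for `i = p^{k+1}`; hence the set of all `[G]` with `G_ab ≅ A` is open and closed
(`isClopen_schAb`). For `G = G_r` the group `G_ab / p^{k+1}` is the quotient of
`M = (ℤ/p^{k+1})^n` by the images of the relations, and these are independent and uniformly
distributed in `M`, because `σ` acts on `M` by `-1` (`FreeProP.pi_oddHaar_abMap`). A subgroup `K`
with `M / K ≅ A` contains the `p`-torsion of `M`, so `K / pK` has order `p^n`, and `n` random
elements of `K` generate it with probability `∏_{i ≤ n} (1 - p^{-i})`. The number of such `K` is the
number of surjections `M → A` divided by `|Aut A|`, and almost all homomorphisms `M → A` are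
surjective for large `n`. This gives `μ_n` of the set (`card_presentations`), and the limit is
`C_∞ / |Aut A|`.
-/

/-! ### Quotients of compact `σ`-groups -/

/-- Two Hausdorff quotients of a compact `σ`-group with the same kernel are `σ`-isomorphic: both
projections are topological quotient maps. -/
theorem SigmaIso.nonempty_of_ker_eq {F X Y : Type*}
    [Group F] [TopologicalSpace F] [SigmaGroup F] [CompactSpace F]
    [Group X] [TopologicalSpace X] [SigmaGroup X] [T2Space X]
    [Group Y] [TopologicalSpace Y] [SigmaGroup Y] [T2Space Y]
    (f : F →* X) (g : F →* Y) (hf : Continuous f) (hg : Continuous g)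
    (hfs : Function.Surjective f) (hgs : Function.Surjective g)
    (hfσ : ∀ x, f (sigma x) = sigma (f x)) (hgσ : ∀ x, g (sigma x) = sigma (g x))
    (h : f.ker = g.ker) : Nonempty (SigmaIso X Y) := by
  let e : X ≃* Y := ((QuotientGroup.quotientKerEquivOfSurjective f hfs).symm.trans
    (QuotientGroup.quotientMulEquivOfEq h)).trans
      (QuotientGroup.quotientKerEquivOfSurjective g hgs)
  have he : ∀ x, e (f x) = g x := by
    intro x
    have : (QuotientGroup.quotientKerEquivOfSurjective f hfs).symm (f x) =
        (QuotientGroup.mk x : F ⧸ f.ker) := by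
      rw [MulEquiv.symm_apply_eq]
      rfl
    change QuotientGroup.quotientKerEquivOfSurjective g hgs
      (QuotientGroup.quotientMulEquivOfEq h
        ((QuotientGroup.quotientKerEquivOfSurjective f hfs).symm (f x))) = _
    rw [this]
    rfl
  have he' : ∀ x, e.symm (g x) = f x := fun x => by rw [MulEquiv.symm_apply_eq, he]
  have qf : IsQuotientMap f := (hf.isClosedMap).isQuotientMap hf hfs
  have qg : IsQuotientMap g := (hg.isClosedMap).isQuotientMap hg hgs
  refine ⟨⟨⟨e, ?_, ?_⟩, ?_⟩⟩
  · refine qf.continuous_iff.2 ?_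
    convert hg using 1
    exact funext he
  · refine qg.continuous_iff.2 ?_
    convert hf using 1
    exact funext he'
  · intro x
    obtain ⟨x, rfl⟩ := hfs x
    change e _ = sigma (e _)
    rw [← hfσ, he, he, hgσ]

/-! ### Dimension subgroups under surjections -/

theorem zassenhaus_isClosed (p : ℕ) [Fact p.Prime] (G : Type*) [Group G] [TopologicalSpace G]
    [IsTopologicalGroup G] (n : ℕ) : IsClosed (zassenhaus p G n : Set G) := by
  rw [zassenhaus.eq_def p G n]
  split_ifs
  · exact isClosed_univ
  · exact Subgroup.isClosed_topologicalClosure _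

theorem zassenhaus_of_one_lt (p : ℕ) [Fact p.Prime] (G : Type*) [Group G] [TopologicalSpace G]
    [IsTopologicalGroup G] {n : ℕ} (hn : 1 < n) : zassenhaus p G n =
    (Subgroup.closure {y | ∃ x ∈ zassenhaus p G ((n + p - 1) / p), x ^ p = y} ⊔
      ⨆ i : {i : ℕ // 0 < i ∧ i < n},
        ⁅zassenhaus p G i.1, zassenhaus p G (n - i.1)⁆).topologicalClosure := by
  rw [zassenhaus.eq_def p G n, dif_neg (by omega)]

theorem zassenhaus_eq_top (p : ℕ) [Fact p.Prime] (G : Type*) [Group G] [TopologicalSpace G]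
    [IsTopologicalGroup G] {n : ℕ} (hn : n ≤ 1) : zassenhaus p G n = ⊤ := by
  rw [zassenhaus.eq_def p G n, dif_pos hn]

theorem ceilDiv_prime_lt {p n : ℕ} (hp : p.Prime) (hn : 1 < n) : (n + p - 1) / p < n := by
  have h2 := hp.two_le
  rw [Nat.div_lt_iff_lt_mul (by omega)]
  obtain ⟨q, rfl⟩ : ∃ q, p = q + 2 := ⟨p - 2, by omega⟩
  obtain ⟨m, rfl⟩ : ∃ m, n = m + 2 := ⟨n - 2, by omega⟩
  have : (m + 2) * (q + 2) = m * q + 2 * m + 2 * q + 4 := by ring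
  omega

/-- A continuous surjection from a compact group maps dimension subgroups onto dimension
subgroups. -/
theorem zassenhaus_le_map (p : ℕ) [Fact p.Prime] {G H : Type*} [Group G] [TopologicalSpace G]
    [IsTopologicalGroup G] [CompactSpace G] [Group H] [TopologicalSpace H] [IsTopologicalGroup H]
    [T2Space H] (f : G →* H) (hf : Continuous f) (hs : Function.Surjective f) (n : ℕ) :
    zassenhaus p H n ≤ (zassenhaus p G n).map f := by
  induction n using Nat.strong_induction_on with
  | _ n ih =>
    rcases le_or_gt n 1 with hn | hn
    · rw [zassenhaus_eq_top p G hn, Subgroup.map_top_of_surjective f hs]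
      exact le_top
    rw [zassenhaus_of_one_lt p H hn]
    have hle := Subgroup.le_topologicalClosure
      (Subgroup.closure {y | ∃ x ∈ zassenhaus p G ((n + p - 1) / p), x ^ p = y} ⊔
      ⨆ i : {i : ℕ // 0 < i ∧ i < n}, ⁅zassenhaus p G i.1, zassenhaus p G (n - i.1)⁆)
    rw [← zassenhaus_of_one_lt p G hn] at hle
    refine Subgroup.topologicalClosure_minimal _ (sup_le ?_ (iSup_le ?_)) ?_
    · rw [Subgroup.closure_le]
      rintro _ ⟨x, hx, rfl⟩
      obtain ⟨y, hy, rfl⟩ := ih _ (ceilDiv_prime_lt Fact.out hn) hx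
      exact ⟨y ^ p, hle (Subgroup.mem_sup_left (Subgroup.subset_closure ⟨y, hy, rfl⟩)),
        map_pow f y p⟩
    · intro i
      refine (Subgroup.commutator_mono (ih _ i.2.2) (ih _ (by have := i.2; omega))).trans ?_
      rw [← Subgroup.map_commutator]
      exact Subgroup.map_mono (((le_iSup (fun i : {i : ℕ // 0 < i ∧ i < n} =>
        ⁅zassenhaus p G i.1, zassenhaus p G (n - i.1)⁆) i).trans le_sup_right).trans hle)
    · exact ((zassenhaus_isClosed p G n).isCompact.image hf).isClosed

/-! ### The free pro-`p`-group: approximation by finite quotients and universal property -/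

namespace FreeProP

variable {p n m : ℕ}

/-- The projection of `F_n` onto the finite quotient attached to `N`. -/
def proj (N : PIndex p n) : FreeProP p n →* PQuot N :=
  (Pi.evalMonoidHom (fun N : PIndex p n => PQuot N) N).comp (freeProPSubgroup p n).subtype

theorem continuous_proj (N : PIndex p n) : Continuous (proj N) :=
  (continuous_apply N).comp continuous_subtype_val

/-- The canonical map from the abstract free group to `F_n`. -/
def ofFree (p n : ℕ) : FreeGroup (Fin n) →* FreeProP p n where
  toFun w := ⟨fun N => (QuotientGroup.mk w : FreeGroup (Fin n) ⧸ N.1), fun _ _ _ => rfl⟩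
  map_one' := rfl
  map_mul' _ _ := rfl

theorem proj_ofFree (N : PIndex p n) (w : FreeGroup (Fin n)) :
    proj N (ofFree p n w) = (QuotientGroup.mk w : FreeGroup (Fin n) ⧸ N.1) := rfl

theorem proj_ofFree_eq_one (N : PIndex p n) (w : FreeGroup (Fin n)) :
    proj N (ofFree p n w) = 1 ↔ w ∈ N.1 := by
  rw [proj_ofFree]
  exact QuotientGroup.eq_one_iff w

theorem exists_proj_ofFree_eq (N : PIndex p n) (g : FreeProP p n) :
    ∃ w, proj N (ofFree p n w) = proj N g := by
  obtain ⟨w, hw⟩ := QuotientGroup.mk_surjective (s := N.1) (proj N g)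
  exact ⟨w, hw⟩

theorem proj_surjective (N : PIndex p n) : Function.Surjective (proj N) := by
  intro x
  obtain ⟨w, hw⟩ := QuotientGroup.mk_surjective (s := N.1) x
  exact ⟨ofFree p n w, hw⟩

theorem proj_eq_one_of_le {M N : PIndex p n} (h : M.1 ≤ N.1) {g : FreeProP p n}
    (hg : proj M g = 1) : proj N g = 1 := by
  have := g.2 M N h
  change PQuot.map M N _ _ (proj M g) = proj N g at this
  rw [← this, hg, map_one]

theorem ext_proj {g h : FreeProP p n} (H : ∀ N, proj N g = proj N h) : g = h :=
  Subtype.ext (funext H)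

theorem card_pQuot (N : PIndex p n) : ∃ k, Nat.card (PQuot N) = p ^ k := N.2.2

theorem isPGroup_pQuot (N : PIndex p n) : IsPGroup p (PQuot N) := by
  obtain ⟨k, hk⟩ := card_pQuot N
  exact IsPGroup.of_card hk

variable [hp : Fact p.Prime]

instance finite_pQuot (N : PIndex p n) : Finite (PQuot N) := by
  obtain ⟨k, hk⟩ := card_pQuot N
  apply Nat.finite_of_card_ne_zero
  rw [hk]
  exact pow_ne_zero _ hp.out.ne_zero

/-- The kernel of a homomorphism to a finite `p`-group. -/
def kerIndex {P : Type*} [Group P] [Finite P] (hP : IsPGroup p P) (f : FreeGroup (Fin n) →* P) :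
    PIndex p n :=
  ⟨f.ker, inferInstance, by
    obtain ⟨k, hk⟩ := IsPGroup.iff_card.1 (hP.to_subgroup f.range)
    exact ⟨k, by rw [Subgroup.index_ker, hk]⟩⟩

/-- A common refinement of two finite quotients. -/
theorem exists_pIndex_le (M N : PIndex p n) : ∃ L : PIndex p n, L.1 ≤ M.1 ∧ L.1 ≤ N.1 := by
  have hP : IsPGroup p (PQuot M × PQuot N) := by
    obtain ⟨k, hk⟩ := card_pQuot M
    obtain ⟨l, hl⟩ := card_pQuot N
    exact IsPGroup.of_card (n := k + l) (by rw [Nat.card_prod, hk, hl, pow_add])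
  refine ⟨kerIndex hP (((proj M).prod (proj N)).comp (ofFree p n)), ?_, ?_⟩
  · intro w hw
    have : (((proj M).prod (proj N)).comp (ofFree p n)) w = 1 := hw
    exact (proj_ofFree_eq_one M w).1 (congrArg Prod.fst this)
  · intro w hw
    have : (((proj M).prod (proj N)).comp (ofFree p n)) w = 1 := hw
    exact (proj_ofFree_eq_one N w).1 (congrArg Prod.snd this)

/-- The kernels of the projections form a basis of neighbourhoods of `1`. -/
theorem exists_ker_proj_subset {U : Set (FreeProP p n)} (hU : U ∈ 𝓝 1) :
    ∃ N : PIndex p n, ∀ g, proj N g = 1 → g ∈ U := by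
  rw [nhds_subtype_eq_comap, mem_comap] at hU
  obtain ⟨t, ht, htU⟩ := hU
  rw [nhds_pi, Filter.mem_pi] at ht
  obtain ⟨I, hI, s, hs, hst⟩ := ht
  have key : ∃ L : PIndex p n, ∀ N ∈ I, L.1 ≤ N.1 := by
    clear hst
    induction I, hI using Set.Finite.induction_on with
    | empty =>
      exact ⟨⟨⊤, inferInstance, 0, by simp⟩, by simp⟩
    | insert _ _ ih =>
      obtain ⟨L, hL⟩ := ih
      rename_i N _ _ _
      obtain ⟨K, hK1, hK2⟩ := exists_pIndex_le L N
      refine ⟨K, ?_⟩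
      rintro M (rfl | hM)
      · exact hK2
      · exact hK1.trans (hL M hM)
  obtain ⟨L, hL⟩ := key
  refine ⟨L, fun g hg => htU (hst ?_)⟩
  intro N hN
  have h1 := proj_eq_one_of_le (hL N hN) hg
  change proj N g ∈ s N
  rw [h1]
  exact mem_of_mem_nhds (hs N)

theorem denseRange_ofFree : DenseRange (ofFree p n) := by
  intro g
  rw [mem_closure_iff_nhds]
  intro U hU
  have hU' : (fun x => g * x) ⁻¹' U ∈ 𝓝 (1 : FreeProP p n) := by
    refine (continuous_const_mul g).continuousAt.preimage_mem_nhds ?_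
    simpa using hU
  obtain ⟨N, hN⟩ := exists_ker_proj_subset hU'
  obtain ⟨w, hw⟩ := exists_proj_ofFree_eq N g
  refine ⟨ofFree p n w, ?_, w, rfl⟩
  have := hN (g⁻¹ * ofFree p n w) (by rw [map_mul, map_inv, hw, inv_mul_cancel])
  simpa using this

/-- A continuous homomorphism on `F_n` is determined by its values on the generators. -/
theorem hom_ext {H : Type*} [Group H] [TopologicalSpace H] [T2Space H]
    {f g : FreeProP p n →* H} (hf : Continuous f) (hg : Continuous g)
    (h : ∀ i, f (gen p i) = g (gen p i)) : f = g := by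
  have h1 : f.comp (ofFree p n) = g.comp (ofFree p n) := by
    ext i
    exact h i
  refine DFunLike.coe_injective (denseRange_ofFree.equalizer hf hg (funext fun w => ?_))
  exact DFunLike.congr_fun h1 w

/-- Universal property with respect to finite `p`-groups. -/
theorem exists_hom_finite {P : Type*} [Group P] [Finite P] [TopologicalSpace P]
    (hP : IsPGroup p P) (y : Fin n → P) :
    ∃ f : FreeProP p n →* P, Continuous f ∧ ∀ i, f (gen p i) = y i := by
  let φ : FreeGroup (Fin n) →* P := FreeGroup.lift y
  let N : PIndex p n := kerIndex hP φ
  let ψ : PQuot N →* P := QuotientGroup.kerLift φ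
  refine ⟨ψ.comp (proj N), ?_, ?_⟩
  · exact (continuous_of_discreteTopology (f := ψ)).comp (continuous_proj N)
  · intro i
    change φ (FreeGroup.of i) = y i
    simp [φ]

/-- Universal property with respect to free pro-`p`-groups. -/
theorem exists_hom (y : Fin n → FreeProP p m) :
    ∃ f : FreeProP p n →* FreeProP p m, Continuous f ∧ ∀ i, f (gen p i) = y i := by
  choose φ hφc hφ using fun N : PIndex p m =>
    exists_hom_finite (isPGroup_pQuot N) (fun i => proj N (y i))
  let f : FreeProP p n →* FreeProP p m :=
    { toFun := fun g => ⟨fun N => φ N g, by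
        intro M N h
        let ψ := PQuot.map M N (MonoidHom.id _) (h.trans_eq (Subgroup.comap_id _).symm)
        have : ψ.comp (φ M) = φ N := by
          refine hom_ext ((continuous_of_discreteTopology (f := ψ)).comp (hφc M)) (hφc N) ?_
          intro i
          change ψ (φ M (gen p i)) = _
          rw [hφ, hφ]
          exact (y i).2 M N h
        exact DFunLike.congr_fun this g⟩
      map_one' := Subtype.ext (funext fun N => map_one _)
      map_mul' := fun a b => Subtype.ext (funext fun N => map_mul _ _ _) }
  refine ⟨f, Continuous.subtype_mk (continuous_pi hφc) _, fun i => ext_proj fun N => hφ N i⟩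

/-- A continuous homomorphism that maps the generators to odd elements is `σ`-equivariant. -/
theorem map_sigma_of_odd {H : Type*} [Group H] [TopologicalSpace H] [T2Space H] [SigmaGroup H]
    {f : FreeProP p n →* H} (hf : Continuous f)
    (h : ∀ i, sigma (f (gen p i)) = (f (gen p i))⁻¹) (x : FreeProP p n) :
    f (sigma x) = sigma (f x) := by
  have : f.comp (sigma : FreeProP p n →* FreeProP p n) = (sigma : H →* H).comp f := by
    refine hom_ext (hf.comp SigmaGroup.continuous_sigma) (SigmaGroup.continuous_sigma.comp hf) ?_
    intro i
    simp [h, sigma_gen]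
  exact DFunLike.congr_fun this x

end FreeProP

/-! ### Burnside's basis theorem and dividing out one odd generator -/

/-- A proper subgroup of a finite `p`-group lies in the kernel of a nontrivial character of
order `p`. -/
theorem IsPGroup.exists_hom_zmod_of_ne_top {p : ℕ} [hp : Fact p.Prime] {P : Type*} [Group P]
    [Finite P] (hP : IsPGroup p P) {H : Subgroup P} (hH : H ≠ ⊤) :
    ∃ χ : P →* Multiplicative (ZMod p), χ ≠ 1 ∧ H ≤ χ.ker := by
  obtain ⟨M, hM, hHM⟩ := (eq_top_or_exists_le_coatom H).resolve_left hH
  have := hP.isNilpotent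
  have : M.Normal := Subgroup.NormalizerCondition.normal_of_coatom M
    Group.normalizerCondition_of_isNilpotent hM
  have hcard : Nat.card (P ⧸ M) = p := by
    obtain ⟨k, hk⟩ := (hP.to_quotient M).exists_card_eq
    have hk0 : k ≠ 0 := by
      rintro rfl
      apply hM.1
      rw [pow_zero] at hk
      exact Subgroup.index_eq_one.1 hk
    obtain ⟨g, hg⟩ := exists_prime_orderOf_dvd_card' (G := P ⧸ M) p
      (hk ▸ dvd_pow_self p hk0)
    have htop : (Subgroup.zpowers g).comap (QuotientGroup.mk' M) = ⊤ := by
      refine hM.2 _ (lt_of_le_of_ne ?_ ?_)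
      · intro x hx
        have : QuotientGroup.mk' M x = 1 := (QuotientGroup.eq_one_iff x).2 hx
        rw [Subgroup.mem_comap, this]
        exact one_mem _
      · intro h
        obtain ⟨x, rfl⟩ := QuotientGroup.mk'_surjective M g
        have hx : x ∈ M := by
          rw [h]
          exact Subgroup.mem_zpowers _
        have : QuotientGroup.mk' M x = 1 := (QuotientGroup.eq_one_iff x).2 hx
        rw [this, orderOf_one] at hg
        exact hp.out.one_lt.ne hg
    have : Subgroup.zpowers g = ⊤ := by
      rw [eq_top_iff]
      intro y _
      obtain ⟨x, rfl⟩ := QuotientGroup.mk'_surjective M y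
      have hx : x ∈ (Subgroup.zpowers g).comap (QuotientGroup.mk' M) := htop ▸ Subgroup.mem_top x
      exact hx
    rw [← hg, ← Nat.card_zpowers, this, Subgroup.card_top]
  let e : P ⧸ M ≃* Multiplicative (ZMod p) := mulEquivOfPrimeCardEq hcard (by simp)
  refine ⟨e.toMonoidHom.comp (QuotientGroup.mk' M), ?_, ?_⟩
  · intro h
    apply hM.1
    rw [eq_top_iff]
    intro x _
    have hx : e (QuotientGroup.mk' M x) = 1 := DFunLike.congr_fun h x
    rw [EmbeddingLike.map_eq_one_iff] at hx
    exact (QuotientGroup.eq_one_iff x).1 hx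
  · intro x hx
    have : QuotientGroup.mk' M x = 1 := (QuotientGroup.eq_one_iff x).2 (hHM hx)
    rw [MonoidHom.mem_ker, MonoidHom.comp_apply, this, map_one]

namespace FreeProP

variable {p n m : ℕ} [hp : Fact p.Prime]

theorem isPGroup_multiplicative_pi_zmod {q : ℕ} (hq : ∃ k, q = p ^ k) :
    IsPGroup p (Multiplicative (Fin n → ZMod q)) := by
  obtain ⟨k, rfl⟩ := hq
  refine IsPGroup.of_card (n := k * n) ?_
  simp [Nat.card_eq_fintype_card, ZMod.card, pow_mul]

theorem exists_abMap {q : ℕ} (hq : ∃ k, q = p ^ k) :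
    ∃ f : FreeProP p n →* Multiplicative (Fin n → ZMod q), Continuous f ∧
      ∀ i, f (gen p i) = Multiplicative.ofAdd (Pi.single i 1) := by
  have : NeZero q := ⟨by
    obtain ⟨k, rfl⟩ := hq
    exact pow_ne_zero _ hp.out.ne_zero⟩
  exact exists_hom_finite (isPGroup_multiplicative_pi_zmod hq) _

/-- The abelianization modulo `q = p ^ k`, mapping the generators to the standard basis. -/
noncomputable def abMap {p n q : ℕ} [Fact p.Prime] (hq : ∃ k, q = p ^ k) :
    FreeProP p n →* Multiplicative (Fin n → ZMod q) := (exists_abMap hq).choose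

theorem continuous_abMap {q : ℕ} (hq : ∃ k, q = p ^ k) :
    Continuous (abMap hq : FreeProP p n →* _) := (exists_abMap hq).choose_spec.1

theorem abMap_gen {q : ℕ} (hq : ∃ k, q = p ^ k) (i : Fin n) :
    abMap hq (gen p i) = Multiplicative.ofAdd (Pi.single i 1) :=
  (exists_abMap hq).choose_spec.2 i

/-- A character of order dividing `q` is a linear form in the coordinates modulo `q`. -/
theorem hom_zmod_eq {q : ℕ} (hq : ∃ k, q = p ^ k)
    (χ : FreeProP p n →* Multiplicative (ZMod q)) (hχ : Continuous χ) (g : FreeProP p n) :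
    (χ g).toAdd = ∑ i, (abMap hq g).toAdd i * (χ (gen p i)).toAdd := by
  let L : Multiplicative (Fin n → ZMod q) →* Multiplicative (ZMod q) :=
    AddMonoidHom.toMultiplicative
      { toFun := fun v => ∑ i, v i * (χ (gen p i)).toAdd
        map_zero' := by simp
        map_add' := by simp [add_mul, Finset.sum_add_distrib] }
  have hL : Continuous L := by
    have h1 : Continuous (fun v : Fin n → ZMod q => ∑ i, v i * (χ (gen p i)).toAdd) := by
      refine continuous_finsetSum _ fun i _ => ?_
      exact (continuous_of_discreteTopology (f := fun z => z * (χ (gen p i)).toAdd)).comp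
        (continuous_apply i)
    exact continuous_ofAdd.comp (h1.comp continuous_toAdd)
  have : χ = L.comp (abMap hq) := by
    refine hom_ext hχ (hL.comp (continuous_abMap hq)) fun i => ?_
    rw [MonoidHom.comp_apply, abMap_gen]
    apply Multiplicative.toAdd.injective
    change _ = ∑ j, (Pi.single i 1 : Fin n → ZMod q) j * (χ (gen p j)).toAdd
    simp [Pi.single_apply]
  exact congrArg Multiplicative.toAdd (DFunLike.congr_fun this g)

/-- Burnside's basis theorem: surjectivity can be tested on characters of order `p`. -/
theorem surjective_of_forall_character {f : FreeProP p m →* FreeProP p n} (hf : Continuous f)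
    (h : ∀ χ : FreeProP p n →* Multiplicative (ZMod p), Continuous χ → χ.comp f = 1 → χ = 1) :
    Function.Surjective f := by
  have key : ∀ N : PIndex p n, Function.Surjective ((proj N).comp f) := by
    intro N
    rw [← MonoidHom.range_eq_top]
    by_contra hN
    obtain ⟨χ, hχ, hle⟩ := (isPGroup_pQuot N).exists_hom_zmod_of_ne_top hN
    apply hχ
    have hc : Continuous (χ.comp (proj N)) :=
      (continuous_of_discreteTopology (f := χ)).comp (continuous_proj N)
    have h0 := h _ hc (by
      ext x
      have : (proj N) (f x) ∈ χ.ker := hle ⟨x, rfl⟩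
      exact this)
    ext y
    obtain ⟨x, rfl⟩ := proj_surjective N y
    exact DFunLike.congr_fun h0 x
  intro y
  have hcl : IsClosed (Set.range f) := (isCompact_range hf).isClosed
  change y ∈ Set.range f
  rw [← hcl.closure_eq, mem_closure_iff_nhds]
  intro U hU
  have hU' : (fun x => y * x) ⁻¹' U ∈ 𝓝 (1 : FreeProP p n) := by
    refine (continuous_const_mul y).continuousAt.preimage_mem_nhds ?_
    simpa using hU
  obtain ⟨N, hN⟩ := exists_ker_proj_subset hU'
  obtain ⟨x, hx⟩ := key N (proj N y)
  refine ⟨f x, ?_, x, rfl⟩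
  have := hN (y⁻¹ * f x) (by
    rw [map_mul, map_inv, ← hx]
    simp)
  simpa using this

/-- `F_n` is Hopfian: the finite set of homomorphisms to a fixed finite `p`-group is mapped
injectively, hence bijectively, to itself by composition with a surjective endomorphism. -/
theorem injective_of_surjective {f : FreeProP p n →* FreeProP p n} (hf : Continuous f)
    (hs : Function.Surjective f) : Function.Injective f := by
  rw [injective_iff_map_eq_one]
  intro x hx
  refine ext_proj fun N => ?_
  rw [map_one]
  let X := {g : FreeProP p n →* PQuot N // Continuous g}
  have hfin : Finite X := by
    refine Finite.of_injective (fun (g : X) (i : Fin n) => g.1 (gen p i)) ?_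
    intro g h hgh
    exact Subtype.ext (hom_ext g.2 h.2 fun i => congrFun hgh i)
  let T : X → X := fun g => ⟨g.1.comp f, g.2.comp hf⟩
  have hT : Function.Injective T := by
    intro g h hgh
    apply Subtype.ext
    ext y
    obtain ⟨x, rfl⟩ := hs y
    exact DFunLike.congr_fun (congrArg Subtype.val hgh) x
  obtain ⟨g, hg⟩ := (Finite.injective_iff_surjective.1 hT) ⟨proj N, continuous_proj N⟩
  have : g.1.comp f = proj N := congrArg Subtype.val hg
  rw [← this, MonoidHom.comp_apply, hx, map_one]

/-- An odd element of `F_{n+1}` with nontrivial image modulo `p` is part of a basis of odd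
elements, so killing it leaves `F_n`. -/
theorem exists_hom_ker_eq_of_abMap_ne_one (hp1 : ∃ k, p = p ^ k)
    (s : OddPart (FreeProP p (n + 1))) (hs : abMap hp1 (s : FreeProP p (n + 1)) ≠ 1) :
    ∃ β : FreeProP p (n + 1) →* FreeProP p n, Continuous β ∧ Function.Surjective β ∧
      (∀ x, β (sigma x) = sigma (β x)) ∧
      β.ker = (Subgroup.normalClosure {(s : FreeProP p (n + 1))}).topologicalClosure := by
  obtain ⟨j, hj⟩ : ∃ j, (abMap hp1 (s : FreeProP p (n + 1))).toAdd j ≠ 0 := by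
    by_contra! h
    exact hs (Multiplicative.toAdd.injective (funext h))
  obtain ⟨α, hαc, hα⟩ := exists_hom (p := p) (n := n + 1) (m := n + 1)
    (Fin.cons (s : FreeProP p (n + 1)) fun i => gen p (j.succAbove i))
  have hα0 : α (gen p 0) = s := hα 0
  have hαs : ∀ i : Fin n, α (gen p i.succ) = gen p (j.succAbove i) := fun i => hα i.succ
  -- a character killing the image of `α` kills `gen p i` for `i ≠ j`, and then `gen p j` as well,
  -- because the `j`-th coordinate of `s` is invertible
  have hsurj : Function.Surjective α := by
    refine surjective_of_forall_character hαc fun χ hχ h1 => ?_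
    have hχs : ∀ i, χ (gen p (j.succAbove i)) = 1 := by
      intro i
      rw [← hαs]
      exact DFunLike.congr_fun h1 _
    have hχj : χ (gen p j) = 1 := by
      have h2 : χ s = 1 := by
        rw [← hα0]
        exact DFunLike.congr_fun h1 _
      have h3 := hom_zmod_eq hp1 χ hχ s
      rw [Fin.sum_univ_succAbove _ j, h2] at h3
      simp only [hχs, toAdd_one, mul_zero, Finset.sum_const_zero, add_zero] at h3
      exact Multiplicative.toAdd.injective ((mul_eq_zero.1 h3.symm).resolve_left hj)
    refine hom_ext hχ continuous_const fun i => ?_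
    rcases Fin.eq_self_or_eq_succAbove j i with rfl | ⟨k, rfl⟩
    · exact hχj
    · exact hχs k
  have hinj := injective_of_surjective hαc hsurj
  let e : FreeProP p (n + 1) ≃* FreeProP p (n + 1) := MulEquiv.ofBijective α ⟨hinj, hsurj⟩
  have he : ∀ x, e x = α x := fun _ => rfl
  have hec : Continuous e.symm := by
    have : IsQuotientMap α := hαc.isClosedMap.isQuotientMap hαc hsurj
    refine this.continuous_iff.2 ?_
    convert continuous_id using 1
    funext x
    exact e.symm_apply_apply x
  have hασ : ∀ x, α (sigma x) = sigma (α x) := by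
    refine map_sigma_of_odd hαc fun i => ?_
    refine Fin.cases ?_ (fun i => ?_) i
    · rw [hα0]
      exact s.2
    · rw [hαs, sigma_gen]
  -- `τ` kills the generator `x_0 = α⁻¹ s`, so `τ ∘ α⁻¹` kills `s`
  obtain ⟨τ, hτc, hτ⟩ := exists_hom (p := p) (n := n + 1) (m := n)
    (Fin.cons 1 fun i => gen p i)
  have hτ0 : τ (gen p 0) = 1 := hτ 0
  have hτs : ∀ i : Fin n, τ (gen p i.succ) = gen p i := fun i => hτ i.succ
  obtain ⟨ε, hεc, hε⟩ := exists_hom (p := p) (n := n) (m := n + 1) fun i => gen p i.succ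
  have hτε : τ.comp ε = MonoidHom.id _ := by
    refine hom_ext (hτc.comp hεc) continuous_id fun i => ?_
    simp [hε, hτs]
  have hτσ : ∀ x, τ (sigma x) = sigma (τ x) := by
    refine map_sigma_of_odd hτc fun i => ?_
    refine Fin.cases ?_ (fun i => ?_) i
    · simp [hτ0]
    · rw [hτs, sigma_gen]
  let L (t : FreeProP p (n + 1)) := (Subgroup.normalClosure {t}).topologicalClosure
  have hLmem : ∀ t, t ∈ L t := fun t =>
    Subgroup.le_topologicalClosure _ (Subgroup.subset_normalClosure rfl)
  have hLn : ∀ t, (L t).Normal := fun t => Subgroup.is_normal_topologicalClosure _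
  have hLc : ∀ t, IsClosed (L t : Set (FreeProP p (n + 1))) :=
    fun t => Subgroup.isClosed_topologicalClosure _
  have hLle : ∀ (t) (K : Subgroup (FreeProP p (n + 1))) [K.Normal],
      IsClosed (K : Set (FreeProP p (n + 1))) → t ∈ K → L t ≤ K := by
    intro t K _ hK ht
    exact Subgroup.topologicalClosure_minimal _
      (Subgroup.normalClosure_le_normal (by simpa using ht)) hK
  refine ⟨τ.comp e.symm.toMonoidHom, hτc.comp hec, ?_, ?_, ?_⟩
  · intro y
    refine ⟨e (ε y), ?_⟩
    change τ (e.symm (e (ε y))) = y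
    rw [e.symm_apply_apply]
    exact DFunLike.congr_fun hτε y
  · intro x
    obtain ⟨x, rfl⟩ := e.surjective x
    change τ (e.symm _) = sigma (τ (e.symm _))
    rw [← hτσ, e.symm_apply_apply, he, ← hασ, ← he, e.symm_apply_apply]
  · apply le_antisymm
    · intro x hx
      obtain ⟨x, rfl⟩ := e.surjective x
      have hx' : τ x = 1 := by
        have h1 : τ (e.symm (e x)) = 1 := hx
        rwa [e.symm_apply_apply] at h1
      -- modulo the generator `x_0`, the identity factors through `τ`
      have hmk : (QuotientGroup.mk' (L (gen p 0))) =
          (QuotientGroup.mk' (L (gen p 0))).comp (ε.comp τ) := by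
        have : IsClosed (L (gen p 0) : Set (FreeProP p (n + 1))) := hLc _
        have hc : Continuous (QuotientGroup.mk' (L (gen p 0))) := QuotientGroup.continuous_mk
        refine hom_ext hc (hc.comp (hεc.comp hτc)) fun i => ?_
        refine Fin.cases ?_ (fun i => ?_) i
        · simp only [MonoidHom.comp_apply, hτ0, map_one]
          exact (QuotientGroup.eq_one_iff _).2 (hLmem _)
        · simp only [MonoidHom.comp_apply, hτs, hε]
      have hxL : x ∈ L (gen p 0) := by
        have := DFunLike.congr_fun hmk x
        simp only [MonoidHom.comp_apply, hx', map_one] at this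
        exact (QuotientGroup.eq_one_iff _).1 this
      have : L (gen p 0) ≤ (L s).comap α := by
        refine hLle _ _ ((hLc _).preimage hαc) ?_
        rw [Subgroup.mem_comap, hα0]
        exact hLmem _
      exact this hxL
    · refine hLle _ _ (isClosed_singleton.preimage (hτc.comp hec)) ?_
      change τ (e.symm s) = 1
      rw [← hα0, ← he, e.symm_apply_apply, hτ0]

end FreeProP

/-! ### Openness of the dimension subgroups and continuity of `Θ_n` -/

open scoped commutatorElement

namespace FreeProP

variable {p n m : ℕ} [hp : Fact p.Prime]

/-- For an open normal subgroup `U` of `F_n`, the closed subgroup generated by `U ^ p` and `[U, U]`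
is open. By Schreier's lemma `U` is finitely generated, so that it has finite index in `U`. -/
theorem exists_proj_eq_one_imp_mem_of_pow_of_commutator (M : PIndex p n) :
    ∃ W : PIndex p n, ∀ T : Subgroup (FreeProP p n), T.Normal →
      IsClosed (T : Set (FreeProP p n)) → (∀ x, proj M x = 1 → x ^ p ∈ T) →
      (∀ x y, proj M x = 1 → proj M y = 1 → ⁅x, y⁆ ∈ T) → ∀ g, proj W g = 1 → g ∈ T := by
  let W : Subgroup (FreeGroup (Fin n)) :=
    Subgroup.normalClosure {y | ∃ x ∈ M.1, x ^ p = y} ⊔ ⁅M.1, M.1⁆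
  have hWM : W ≤ M.1 := by
    refine sup_le (Subgroup.normalClosure_le_normal ?_) (Subgroup.commutator_le_left _ _)
    rintro _ ⟨x, hx, rfl⟩
    exact pow_mem hx p
  have hfi : M.1.FiniteIndex := ⟨by
    obtain ⟨k, hk⟩ := M.2.2
    rw [hk]
    exact pow_ne_zero _ hp.out.ne_zero⟩
  have hfg : Group.FG M.1 := inferInstance
  let K := W.subgroupOf M.1
  let Q := M.1 ⧸ K
  have hcomm : ∀ a b : Q, a * b = b * a := by
    intro a b
    obtain ⟨x, rfl⟩ := QuotientGroup.mk_surjective a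
    obtain ⟨y, rfl⟩ := QuotientGroup.mk_surjective b
    rw [← QuotientGroup.mk_mul, ← QuotientGroup.mk_mul, QuotientGroup.eq]
    rw [Subgroup.mem_subgroupOf]
    have : ((x * y)⁻¹ * (y * x) : M.1) = ⁅y⁻¹, x⁻¹⁆ := by group
    rw [this]
    exact Subgroup.mem_sup_right
      (Subgroup.commutator_mem_commutator (inv_mem y.2) (inv_mem x.2))
  let _ : CommGroup Q := { (inferInstance : Group Q) with mul_comm := hcomm }
  have hpow : ∀ a : Q, a ^ p = 1 := by
    intro a
    obtain ⟨x, rfl⟩ := QuotientGroup.mk_surjective a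
    rw [← QuotientGroup.mk_pow, QuotientGroup.eq_one_iff, Subgroup.mem_subgroupOf]
    exact Subgroup.mem_sup_left (Subgroup.subset_normalClosure ⟨x, x.2, rfl⟩)
  have hQfg : Group.FG Q := QuotientGroup.fg K
  have hQfin : Finite Q := CommGroup.finite_of_fg_isMulTorsion Q
    fun a => isOfFinOrder_iff_pow_eq_one.2 ⟨p, hp.out.pos, hpow a⟩
  have hQp : IsPGroup p Q := fun a => ⟨1, by rw [pow_one, hpow]⟩
  obtain ⟨k, hk⟩ := hQp.exists_card_eq
  obtain ⟨l, hl⟩ := M.2.2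
  refine ⟨⟨W, inferInstance, k + l, ?_⟩, ?_⟩
  · rw [← Subgroup.relIndex_mul_index hWM, hl, pow_add, ← hk]
    rfl
  intro T hT hTc h1 h2 g hg
  have hWT : W ≤ T.comap (ofFree p n) := by
    refine sup_le (Subgroup.normalClosure_le_normal ?_) ?_
    · rintro _ ⟨x, hx, rfl⟩
      change ofFree p n (x ^ p) ∈ T
      rw [map_pow]
      exact h1 _ ((proj_ofFree_eq_one M x).2 hx)
    · rw [Subgroup.commutator_le]
      intro x hx y hy
      rw [Subgroup.mem_comap, map_commutatorElement]
      exact h2 _ _ ((proj_ofFree_eq_one M x).2 hx) ((proj_ofFree_eq_one M y).2 hy)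
  change g ∈ (T : Set (FreeProP p n))
  rw [← hTc.closure_eq, mem_closure_iff]
  intro U hU hgU
  set N : PIndex p n := ⟨W, _⟩
  have hV : IsOpen (U ∩ proj N ⁻¹' {1}) :=
    hU.inter ((isOpen_discrete _).preimage (continuous_proj N))
  obtain ⟨w, hw⟩ := denseRange_ofFree.exists_mem_open hV ⟨g, hgU, hg⟩
  exact ⟨ofFree p n w, hw.1, hWT ((proj_ofFree_eq_one N w).1 hw.2)⟩

/-- The dimension subgroups of `F_n` are open. -/
theorem exists_ker_proj_le_zassenhaus (i : ℕ) :
    ∃ N : PIndex p n, (proj N).ker ≤ zassenhaus p (FreeProP p n) i := by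
  induction i using Nat.strong_induction_on with
  | _ i ih =>
    rcases le_or_gt i 1 with hi | hi
    · rw [zassenhaus_eq_top p _ hi]
      exact ⟨⟨⊤, inferInstance, 0, by simp⟩, le_top⟩
    obtain ⟨N₁, h₁⟩ := ih _ (ceilDiv_prime_lt hp.out hi)
    obtain ⟨N₂, h₂⟩ := ih (i - 1) (by omega)
    obtain ⟨M, hM₁, hM₂⟩ := exists_pIndex_le N₁ N₂
    obtain ⟨W, hW⟩ := exists_proj_eq_one_imp_mem_of_pow_of_commutator M
    have hle := Subgroup.le_topologicalClosure
      (Subgroup.closure {y | ∃ x ∈ zassenhaus p (FreeProP p n) ((i + p - 1) / p), x ^ p = y} ⊔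
      ⨆ j : {j : ℕ // 0 < j ∧ j < i},
        ⁅zassenhaus p (FreeProP p n) j.1, zassenhaus p (FreeProP p n) (i - j.1)⁆)
    rw [← zassenhaus_of_one_lt p (FreeProP p n) hi] at hle
    refine ⟨W, fun g hg => hW _ inferInstance (zassenhaus_isClosed p _ i) ?_ ?_ g hg⟩
    · intro x hx
      exact hle (Subgroup.mem_sup_left (Subgroup.subset_closure
        ⟨x, h₁ (proj_eq_one_of_le hM₁ hx), rfl⟩))
    · intro x y _ hy
      refine hle (Subgroup.mem_sup_right ?_)
      refine (le_iSup (fun j : {j : ℕ // 0 < j ∧ j < i} =>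
        ⁅zassenhaus p (FreeProP p n) j.1, zassenhaus p (FreeProP p n) (i - j.1)⁆)
          ⟨1, by omega⟩) ?_
      refine Subgroup.commutator_mem_commutator ?_ (h₂ (proj_eq_one_of_le hM₂ hy))
      rw [zassenhaus_eq_top p _ le_rfl]
      exact Subgroup.mem_top x

end FreeProP

open FreeProP

instance {p n : ℕ} (r : OddTuple p n) : IsClosed (relSubgroup r : Set (FreeProP p n)) :=
  Subgroup.isClosed_topologicalClosure _

instance (p : ℕ) [Fact p.Prime] (G : Type*) [Group G] [TopologicalSpace G]
    [IsTopologicalGroup G] (n : ℕ) : IsClosed (zassenhaus p G n : Set G) :=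
  zassenhaus_isClosed p G n

section

variable {p n m : ℕ}

theorem relSubgroup_le {r : OddTuple p n} {K : Subgroup (FreeProP p n)} [K.Normal]
    (hK : IsClosed (K : Set (FreeProP p n))) (h : ∀ i, (r i : FreeProP p n) ∈ K) :
    relSubgroup r ≤ K := by
  refine Subgroup.topologicalClosure_minimal _ (Subgroup.normalClosure_le_normal ?_) hK
  rintro _ ⟨i, rfl⟩
  exact h i

theorem mem_relSubgroup (r : OddTuple p n) (i : Fin n) : (r i : FreeProP p n) ∈ relSubgroup r :=
  Subgroup.le_topologicalClosure _ (Subgroup.subset_normalClosure ⟨i, rfl⟩)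

theorem Theta_eq_iff {r : OddTuple p n} {s : OddTuple p m} :
    Theta p n r = Theta p m s ↔ Nonempty (SigmaIso (SchurGroup r) (SchurGroup s)) :=
  Quotient.eq (r := schurSetoid p)

variable [hp : Fact p.Prime]

theorem SigmaIso.nonempty_zassenhaus_quotient {G H : Type*}
    [Group G] [TopologicalSpace G] [IsTopologicalGroup G] [SigmaGroup G] [CompactSpace G]
    [Group H] [TopologicalSpace H] [IsTopologicalGroup H] [SigmaGroup H]
    (e : SigmaIso G H) (i : ℕ) :
    Nonempty (SigmaIso (G ⧸ zassenhaus p G i) (H ⧸ zassenhaus p H i)) := by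
  let φ := e.toContinuousMulEquiv
  refine SigmaIso.nonempty_of_ker_eq (QuotientGroup.mk' _)
    ((QuotientGroup.mk' (zassenhaus p H i)).comp φ.toMulEquiv.toMonoidHom)
    QuotientGroup.continuous_mk (QuotientGroup.continuous_mk.comp φ.continuous)
    (QuotientGroup.mk'_surjective _) ((QuotientGroup.mk'_surjective _).comp φ.surjective)
    (fun x => rfl) ?_ ?_
  · intro x
    change QuotientGroup.mk' (zassenhaus p H i) (φ (sigma x)) = _
    rw [e.map_sigma]
    rfl
  · apply le_antisymm
    · intro x hx
      have hx' : x ∈ zassenhaus p G i := (QuotientGroup.eq_one_iff x).1 hx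
      exact (QuotientGroup.eq_one_iff (φ x)).2
        (zassenhaus_le_comap p φ.toMulEquiv.toMonoidHom φ.continuous i hx')
    · intro x hx
      have hx' : φ x ∈ zassenhaus p H i := (QuotientGroup.eq_one_iff (φ x)).1 hx
      have := zassenhaus_le_comap p φ.symm.toMulEquiv.toMonoidHom φ.symm.continuous i hx'
      refine (QuotientGroup.eq_one_iff x).2 ?_
      have h2 : φ.symm (φ x) ∈ zassenhaus p G i := this
      rwa [φ.symm_apply_apply] at h2

/-- The projection `F_n → G_r / D_i(G_r)`. -/
def toZassenhausQuotient (r : OddTuple p n) (i : ℕ) :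
    FreeProP p n →* SchurGroup r ⧸ zassenhaus p (SchurGroup r) i :=
  (QuotientGroup.mk' _).comp (QuotientGroup.mk' (relSubgroup r))

theorem continuous_toZassenhausQuotient (r : OddTuple p n) (i : ℕ) :
    Continuous (toZassenhausQuotient r i) :=
  QuotientGroup.continuous_mk.comp QuotientGroup.continuous_mk

theorem toZassenhausQuotient_surjective (r : OddTuple p n) (i : ℕ) :
    Function.Surjective (toZassenhausQuotient r i) :=
  (QuotientGroup.mk'_surjective _).comp (QuotientGroup.mk'_surjective _)

theorem zassenhaus_le_ker_toZassenhausQuotient (r : OddTuple p n) (i : ℕ) :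
    zassenhaus p (FreeProP p n) i ≤ (toZassenhausQuotient r i).ker := by
  intro x hx
  exact (QuotientGroup.eq_one_iff _).2 (zassenhaus_le_comap p (QuotientGroup.mk' (relSubgroup r))
    QuotientGroup.continuous_mk i hx)

theorem ker_toZassenhausQuotient_le {r s : OddTuple p n} {i : ℕ}
    (h : ∀ k, (s k : FreeProP p n)⁻¹ * r k ∈ zassenhaus p (FreeProP p n) i) :
    (toZassenhausQuotient r i).ker ≤ (toZassenhausQuotient s i).ker := by
  have hr : relSubgroup r ≤ (toZassenhausQuotient s i).ker := by
    refine relSubgroup_le (isClosed_singleton.preimage (continuous_toZassenhausQuotient s i)) ?_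
    intro k
    have h1 := zassenhaus_le_ker_toZassenhausQuotient s i (h k)
    have h2 : toZassenhausQuotient s i (s k) = 1 := by
      have : QuotientGroup.mk' (relSubgroup s) (s k) = 1 :=
        (QuotientGroup.eq_one_iff _).2 (mem_relSubgroup s k)
      rw [toZassenhausQuotient, MonoidHom.comp_apply, this, map_one]
    rw [MonoidHom.mem_ker, map_mul, map_inv, h2] at h1
    simpa using h1
  intro x hx
  have hx' : QuotientGroup.mk' (relSubgroup r) x ∈ zassenhaus p (SchurGroup r) i :=
    (QuotientGroup.eq_one_iff _).1 hx
  obtain ⟨y, hy, hxy⟩ := zassenhaus_le_map p (QuotientGroup.mk' (relSubgroup r))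
    QuotientGroup.continuous_mk (QuotientGroup.mk'_surjective _) i hx'
  have h1 : y⁻¹ * x ∈ relSubgroup r := QuotientGroup.eq.1 hxy
  have h2 := mul_mem (zassenhaus_le_ker_toZassenhausQuotient s i hy) (hr h1)
  rwa [mul_inv_cancel_left] at h2

/-- `G_r / D_i(G_r)` depends only on the relations modulo `D_i(F_n)`. -/
theorem nonempty_sigmaIso_quotient_of_congr {r s : OddTuple p n} {i : ℕ}
    (h : ∀ k, (s k : FreeProP p n)⁻¹ * r k ∈ zassenhaus p (FreeProP p n) i) :
    Nonempty (SigmaIso (SchurGroup r ⧸ zassenhaus p (SchurGroup r) i)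
      (SchurGroup s ⧸ zassenhaus p (SchurGroup s) i)) := by
  refine SigmaIso.nonempty_of_ker_eq (toZassenhausQuotient r i) (toZassenhausQuotient s i)
    (continuous_toZassenhausQuotient r i) (continuous_toZassenhausQuotient s i)
    (toZassenhausQuotient_surjective r i) (toZassenhausQuotient_surjective s i)
    (fun _ => rfl) (fun _ => rfl)
    (le_antisymm (ker_toZassenhausQuotient_le h) (ker_toZassenhausQuotient_le fun k => ?_))
  have := inv_mem (h k)
  simpa using this

theorem Theta_mem_schNhd {i : ℕ} {r : OddTuple p n} {s : OddTuple p m} :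
    Theta p n r ∈ schNhd p i s ↔
      Nonempty (SigmaIso (SchurGroup r ⧸ zassenhaus p (SchurGroup r) i)
        (SchurGroup s ⧸ zassenhaus p (SchurGroup s) i)) := by
  constructor
  · rintro ⟨k, t, ht, ⟨e⟩⟩
    obtain ⟨f⟩ := Theta_eq_iff.1 ht
    obtain ⟨g⟩ := f.nonempty_zassenhaus_quotient (p := p) i
    exact ⟨g.symm.trans e⟩
  · intro h
    exact ⟨n, r, rfl, h⟩

theorem continuous_Theta (p n : ℕ) [Fact p.Prime] : Continuous (Theta p n) := by
  refine continuous_generateFrom_iff.2 ?_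
  rintro _ ⟨i, m, s, -, rfl⟩
  rw [isOpen_iff_mem_nhds]
  intro r hr
  obtain ⟨N, hN⟩ := exists_ker_proj_le_zassenhaus (p := p) (n := n) i
  have hO : IsOpen {t : OddTuple p n | ∀ k, proj N (t k : FreeProP p n) = proj N (r k)} := by
    rw [Set.ofPred_forall]
    refine isOpen_iInter_of_finite fun k => ?_
    have hc : Continuous fun t : OddTuple p n => proj N (t k : FreeProP p n) :=
      (continuous_proj N).comp (continuous_subtype_val.comp (continuous_apply k))
    exact (isOpen_discrete {proj N (r k : FreeProP p n)}).preimage hc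
  refine mem_of_superset (hO.mem_nhds fun k => rfl) ?_
  intro t ht
  obtain ⟨e⟩ := Theta_mem_schNhd.1 hr
  obtain ⟨f⟩ := nonempty_sigmaIso_quotient_of_congr (r := t) (s := r) (i := i) fun k => hN (by
    rw [MonoidHom.mem_ker, map_mul, map_inv, ht k, inv_mul_cancel])
  exact Theta_mem_schNhd.2 ⟨f.trans e⟩

end

/-! ### The odd part of `F_n` and its Haar measure -/

theorem closure_range_single_eq_top (n q : ℕ) [NeZero q] :
    Subgroup.closure (Set.range fun i : Fin n =>
      (Multiplicative.ofAdd (Pi.single i 1) : Multiplicative (Fin n → ZMod q))) = ⊤ := by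
  rw [eq_top_iff]
  intro v _
  have hsingle : ∀ (i : Fin n) (c : ZMod q), Multiplicative.ofAdd (Pi.single i c) ∈
      Subgroup.closure (Set.range fun i : Fin n =>
        (Multiplicative.ofAdd (Pi.single i 1) : Multiplicative (Fin n → ZMod q))) := by
    intro i c
    have : (Multiplicative.ofAdd (Pi.single i c) : Multiplicative (Fin n → ZMod q)) =
        Multiplicative.ofAdd (Pi.single i 1) ^ c.val := by
      rw [← ofAdd_nsmul, ← Pi.single_smul, nsmul_one, ZMod.natCast_zmod_val]
    rw [this]
    exact pow_mem (Subgroup.subset_closure (Set.mem_range_self i)) _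
  have : v = ∏ i, Multiplicative.ofAdd (Pi.single i (v.toAdd i) : Fin n → ZMod q) := by
    rw [← ofAdd_sum, Finset.univ_sum_single]
    rfl
  rw [this]
  exact prod_mem fun i _ => hsingle i _

namespace FreeProP

variable {p n m : ℕ}

theorem not_prime_dvd_two (h2 : 2 < p) : ¬ p ∣ 2 :=
  fun h => absurd (Nat.le_of_dvd two_pos h) (not_le.2 h2)

theorem sq_of_even_mul_odd (a : EvenPart (FreeProP p n)) (b : OddPart (FreeProP p n)) :
    (b : FreeProP p n) ^ 2 = (sigma (a * b : FreeProP p n))⁻¹ * (a * b) := by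
  rw [map_mul, a.2, b.2, sq]
  group

variable [hp : Fact p.Prime]

theorem coprime_card_pQuot {k : ℕ} (hk : ¬ p ∣ k) (N : PIndex p n) :
    (Nat.card (PQuot N)).Coprime k := by
  obtain ⟨l, hl⟩ := card_pQuot N
  rw [hl]
  exact Nat.Coprime.pow_left _ ((Nat.Prime.coprime_iff_not_dvd hp.out).2 hk)

theorem sq_injective (h2 : 2 < p) {a b : FreeProP p n} (h : a ^ 2 = b ^ 2) : a = b := by
  refine ext_proj fun N => (powCoprime (coprime_card_pQuot (not_prime_dvd_two h2) N)).injective ?_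
  rw [powCoprime_apply, powCoprime_apply, ← map_pow, h, map_pow]

/-- Square roots in `F_n` exist for odd `p` and depend continuously on the element. -/
theorem exists_continuous_sqrt (h2 : 2 < p) :
    ∃ s : FreeProP p n → FreeProP p n, Continuous s ∧ ∀ g, s g ^ 2 = g := by
  let e (N : PIndex p n) : PQuot N ≃ PQuot N :=
    powCoprime (coprime_card_pQuot (not_prime_dvd_two h2) N)
  have he : ∀ N x, (e N).symm x ^ 2 = x := fun N x => (e N).apply_symm_apply x
  refine ⟨fun g => ⟨fun N => (e N).symm (proj N g), fun M N h => ?_⟩, ?_, ?_⟩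
  · apply (e N).injective
    rw [Equiv.apply_symm_apply]
    change (PQuot.map M N _ _ _) ^ 2 = _
    rw [← map_pow, he]
    exact g.2 M N h
  · refine Continuous.subtype_mk (continuous_pi fun N => ?_) _
    exact (continuous_of_discreteTopology (f := (e N).symm)).comp (continuous_proj N)
  · intro g
    exact ext_proj fun N => he N (proj N g)

theorem exists_even_mul_odd (h2 : 2 < p) (g : FreeProP p n) :
    ∃ ab : EvenPart (FreeProP p n) × OddPart (FreeProP p n),
      (ab.1 : FreeProP p n) * (ab.2 : FreeProP p n) = g := by
  obtain ⟨s, -, hs⟩ := exists_continuous_sqrt (n := n) h2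
  let b := s ((sigma g)⁻¹ * g)
  have hb2 : b ^ 2 = (sigma g)⁻¹ * g := hs _
  have hb : sigma b = b⁻¹ := by
    apply sq_injective h2
    rw [← map_pow, inv_pow, hb2]
    simp [sigma_sigma]
  refine ⟨⟨⟨g * b⁻¹, ?_⟩, ⟨b, hb⟩⟩, by simp⟩
  rw [map_mul, map_inv, hb, inv_inv]
  calc sigma g * b = sigma g * b ^ 2 * b⁻¹ := by group
    _ = g * b⁻¹ := by rw [hb2]; group

/-- The odd part `b` of `g = a b` is characterized by `b ^ 2 = (σ g)⁻¹ g`. -/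
theorem oddProj_sq (h2 : 2 < p) (g : FreeProP p n) :
    (oddProj p n g : FreeProP p n) ^ 2 = (sigma g)⁻¹ * g := by
  have h := Function.invFun_eq (exists_even_mul_odd h2 g)
  have h3 := sq_of_even_mul_odd (Function.invFun
    (fun ab : EvenPart (FreeProP p n) × OddPart (FreeProP p n) =>
      (ab.1 : FreeProP p n) * (ab.2 : FreeProP p n)) g).1 (oddProj p n g)
  rw [h3]
  rw [oddProj, h]

theorem oddProj_eq (h2 : 2 < p) {g : FreeProP p n} {b : OddPart (FreeProP p n)}
    (h : (b : FreeProP p n) ^ 2 = (sigma g)⁻¹ * g) : oddProj p n g = b :=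
  Subtype.ext (sq_injective h2 (by rw [oddProj_sq h2, h]))

theorem continuous_oddProj (h2 : 2 < p) : Continuous (oddProj p n) := by
  obtain ⟨s, hsc, hs⟩ := exists_continuous_sqrt (n := n) h2
  have : ∀ g, (oddProj p n g : FreeProP p n) = s ((sigma g)⁻¹ * g) := fun g =>
    sq_injective h2 (by rw [oddProj_sq h2, hs])
  refine continuous_induced_rng.2 ?_
  have hc : Continuous fun g : FreeProP p n => s ((sigma g)⁻¹ * g) :=
    hsc.comp ((SigmaGroup.continuous_sigma.inv).mul continuous_id)
  convert hc using 1
  exact funext this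

/-- The map on odd parts induced by a `σ`-equivariant homomorphism. -/
def oddMap (β : FreeProP p m →* FreeProP p n) (hβ : ∀ x, β (sigma x) = sigma (β x))
    (r : OddPart (FreeProP p m)) : OddPart (FreeProP p n) :=
  ⟨β r, by rw [← hβ, r.2, map_inv]⟩

theorem oddMap_oddProj (h2 : 2 < p) (β : FreeProP p m →* FreeProP p n)
    (hβ : ∀ x, β (sigma x) = sigma (β x)) (g : FreeProP p m) :
    oddMap β hβ (oddProj p m g) = oddProj p n (β g) := by
  refine (oddProj_eq h2 ?_).symm
  change β _ ^ 2 = _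
  rw [← map_pow, oddProj_sq h2, map_mul, map_inv, hβ]

instance countable_pIndex : Countable (PIndex p n) := by
  have hfg : ∀ N : PIndex p n, N.1.FG := by
    intro N
    have : N.1.FiniteIndex := ⟨by
      obtain ⟨k, hk⟩ := N.2.2
      rw [hk]
      exact pow_ne_zero _ hp.out.ne_zero⟩
    exact (Group.fg_iff_subgroup_fg N.1).1 inferInstance
  choose S hS using hfg
  have : Countable (FreeGroup (Fin n)) := Quot.mk_surjective.countable
  refine Function.Injective.countable (f := S) fun M N h => Subtype.ext ?_
  rw [← hS M, ← hS N, h]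

instance : SecondCountableTopology (FreeProP p n) :=
  haveI : ∀ N : PIndex p n, SecondCountableTopology (PQuot N) := fun _ => inferInstance
  TopologicalSpace.Subtype.secondCountableTopology
    (freeProPSubgroup p n : Set (∀ N : PIndex p n, PQuot N))

instance : SecondCountableTopology (OddPart (FreeProP p n)) :=
  TopologicalSpace.Subtype.secondCountableTopology {a : FreeProP p n | sigma a = a⁻¹}

/-- The normalized Haar measure on `F_n`. -/
noncomputable abbrev haar (p n : ℕ) [Fact p.Prime] : Measure (FreeProP p n) :=
  Measure.haarMeasure (⊤ : TopologicalSpace.PositiveCompacts (FreeProP p n))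

instance : IsProbabilityMeasure (haar p n) :=
  ⟨Measure.haarMeasure_self (K₀ := (⊤ : TopologicalSpace.PositiveCompacts (FreeProP p n)))⟩

instance : IsFiniteMeasure (oddHaar p n) :=
  inferInstanceAs (IsFiniteMeasure ((haar p n).map (oddProj p n)))

instance : SigmaFinite (oddHaar p n) := IsFiniteMeasure.toSigmaFinite _

theorem isProbabilityMeasure_oddHaar (h2 : 2 < p) : IsProbabilityMeasure (oddHaar p n) :=
  Measure.isProbabilityMeasure_map (continuous_oddProj h2).aemeasurable

/-- By uniqueness of the Haar measure. -/
theorem map_haar {β : FreeProP p m →* FreeProP p n} (hc : Continuous β)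
    (hs : Function.Surjective β) : (haar p m).map β = haar p n := by
  have := Measure.isHaarMeasure_map_of_isFiniteMeasure (haar p m) β hc hs
  have : IsProbabilityMeasure ((haar p m).map β) :=
    Measure.isProbabilityMeasure_map hc.aemeasurable
  exact Measure.isHaarMeasure_eq_of_isProbabilityMeasure _ _

theorem measurePreserving_oddMap (h2 : 2 < p) {β : FreeProP p m →* FreeProP p n}
    (hc : Continuous β) (hs : Function.Surjective β) (hβ : ∀ x, β (sigma x) = sigma (β x)) :
    MeasurePreserving (oddMap β hβ) (oddHaar p m) (oddHaar p n) := by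
  have hm : Measurable (oddMap β hβ) :=
    (Continuous.subtype_mk (hc.comp continuous_subtype_val) _).measurable
  refine ⟨hm, ?_⟩
  unfold oddHaar
  rw [Measure.map_map hm (continuous_oddProj h2).measurable]
  have : oddMap β hβ ∘ oddProj p m = oddProj p n ∘ β := funext fun g => oddMap_oddProj h2 β hβ g
  rw [this, ← Measure.map_map (continuous_oddProj h2).measurable hc.measurable]
  change ((haar p m).map β).map _ = _
  rw [map_haar hc hs]

theorem abMap_sigma {q : ℕ} (hq : ∃ k, q = p ^ k) (g : FreeProP p n) :
    abMap hq (sigma g) = (abMap hq g)⁻¹ := by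
  have : (abMap hq).comp (sigma : FreeProP p n →* FreeProP p n) =
      (invMonoidHom (α := Multiplicative (Fin n → ZMod q))).comp (abMap hq) := by
    refine hom_ext ((continuous_abMap hq).comp SigmaGroup.continuous_sigma)
      ((continuous_abMap hq).inv) fun i => ?_
    simp [sigma_gen]
  exact DFunLike.congr_fun this g

theorem abMap_surjective {q : ℕ} (hq : ∃ k, q = p ^ k) :
    Function.Surjective (abMap hq : FreeProP p n →* _) := by
  have : NeZero q := ⟨by
    obtain ⟨k, rfl⟩ := hq
    exact pow_ne_zero _ hp.out.ne_zero⟩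
  rw [← MonoidHom.range_eq_top, eq_top_iff, ← closure_range_single_eq_top, Subgroup.closure_le]
  rintro _ ⟨i, rfl⟩
  exact ⟨gen p i, abMap_gen hq i⟩

/-- `σ` acts by inversion on `(ℤ/q)^n`, a group of odd order, so even elements are killed. -/
theorem abMap_oddProj (h2 : 2 < p) {q : ℕ} (hq : ∃ k, q = p ^ k) (g : FreeProP p n) :
    abMap hq (oddProj p n g : FreeProP p n) = abMap hq g := by
  have hinj : ∀ x y : Multiplicative (Fin n → ZMod q), x ^ 2 = y ^ 2 → x = y := by
    have hP := isPGroup_multiplicative_pi_zmod (p := p) (n := n) hq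
    exact fun x y h => (hP.powEquiv ((Nat.Prime.coprime_iff_not_dvd hp.out).2
      (not_prime_dvd_two h2))).injective h
  apply hinj
  rw [← map_pow, oddProj_sq h2, map_mul, map_inv, abMap_sigma, inv_inv, sq]

theorem haar_abMap_fiber {q : ℕ} (hq : ∃ k, q = p ^ k)
    (v : Multiplicative (Fin n → ZMod q)) :
    haar p n {g | abMap hq g = v} = ((q : ENNReal) ^ n)⁻¹ := by
  have : NeZero q := ⟨by
    obtain ⟨k, rfl⟩ := hq
    exact pow_ne_zero _ hp.out.ne_zero⟩
  have hmeas : ∀ v : Multiplicative (Fin n → ZMod q), MeasurableSet {g | abMap hq g = v} :=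
    fun v => ((isOpen_discrete {v}).preimage (continuous_abMap hq)).measurableSet
  have htrans : ∀ v, haar p n {g | abMap hq g = v} = haar p n {g | abMap hq g = 1} := by
    intro v
    obtain ⟨h, rfl⟩ := abMap_surjective hq v
    rw [← measure_preimage_mul (haar p n) h {g | abMap hq g = abMap hq h}]
    congr 1
    ext g
    simp
  have hsum : ∑ v : Multiplicative (Fin n → ZMod q), haar p n {g | abMap hq g = v} = 1 := by
    have h := sum_measure_preimage_singleton (μ := haar p n)
      (Finset.univ : Finset (Multiplicative (Fin n → ZMod q))) (f := abMap hq)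
      fun v _ => hmeas v
    rw [Finset.coe_univ, Set.preimage_univ, measure_univ] at h
    exact h
  rw [Finset.sum_congr rfl fun v _ => htrans v] at hsum
  rw [htrans]
  simp only [Finset.sum_const, Finset.card_univ, nsmul_eq_mul] at hsum
  rw [show Fintype.card (Multiplicative (Fin n → ZMod q)) = q ^ n by simp] at hsum
  rw [mul_comm] at hsum
  exact ENNReal.eq_inv_of_mul_eq_one_left (by exact_mod_cast hsum)

theorem oddHaar_abMap_fiber (h2 : 2 < p) {q : ℕ} (hq : ∃ k, q = p ^ k)
    (v : Multiplicative (Fin n → ZMod q)) :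
    oddHaar p n {r | abMap hq (r : FreeProP p n) = v} = ((q : ENNReal) ^ n)⁻¹ := by
  have hmeas : MeasurableSet {r : OddPart (FreeProP p n) | abMap hq (r : FreeProP p n) = v} :=
    ((isOpen_discrete {v}).preimage
      ((continuous_abMap hq).comp continuous_subtype_val)).measurableSet
  rw [oddHaar, Measure.map_apply (continuous_oddProj h2).measurable hmeas,
    ← haar_abMap_fiber hq v]
  congr 1
  ext g
  exact (abMap_oddProj h2 hq g).congr_left

/-- The images modulo `q` of `n` random odd relations are uniformly distributed. -/
theorem pi_oddHaar_abMap (h2 : 2 < p) {q : ℕ} (hq : ∃ k, q = p ^ k)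
    (E : Set (Fin n → Multiplicative (Fin n → ZMod q))) :
    (Measure.pi fun _ : Fin n => oddHaar p n)
      {r | (fun i => abMap hq (r i : FreeProP p n)) ∈ E} =
        (Nat.card E : ENNReal) / (q : ENNReal) ^ (n * n) := by
  have : NeZero q := ⟨by
    obtain ⟨k, rfl⟩ := hq
    exact pow_ne_zero _ hp.out.ne_zero⟩
  have := isProbabilityMeasure_oddHaar (n := n) h2
  classical
  have hfiber : ∀ t : Fin n → Multiplicative (Fin n → ZMod q),
      (fun (r : OddTuple p n) i => abMap hq (r i : FreeProP p n)) ⁻¹' {t} =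
        Set.univ.pi fun i => {b : OddPart (FreeProP p n) | abMap hq (b : FreeProP p n) = t i} := by
    intro t
    ext r
    simp [funext_iff]
  have hmeas : ∀ (w : Multiplicative (Fin n → ZMod q)),
      MeasurableSet {r : OddPart (FreeProP p n) | abMap hq (r : FreeProP p n) = w} :=
    fun w => ((isOpen_discrete {w}).preimage
      ((continuous_abMap hq).comp continuous_subtype_val)).measurableSet
  have h := sum_measure_preimage_singleton (μ := Measure.pi fun _ : Fin n => oddHaar p n)
    E.toFinset (f := fun (r : OddTuple p n) i => abMap hq (r i : FreeProP p n)) fun t _ => by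
      rw [hfiber]
      exact MeasurableSet.univ_pi fun i => hmeas _
  rw [Set.coe_toFinset] at h
  change _ = (Measure.pi fun _ : Fin n => oddHaar p n)
      {r | (fun i => abMap hq (r i : FreeProP p n)) ∈ E} at h
  rw [← h]
  simp only [hfiber, Measure.pi_pi, oddHaar_abMap_fiber h2 hq]
  simp only [Finset.prod_const, Finset.sum_const, Finset.card_univ, Fintype.card_fin,
    nsmul_eq_mul, Set.toFinset_card, Nat.card_eq_fintype_card]
  rw [ENNReal.div_eq_inv_mul, mul_comm, pow_mul]
  simp only [ENNReal.inv_pow]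

end FreeProP

/-! ### The constant `C_∞` -/

section

theorem summable_inv_prime_pow_succ {p : ℕ} (hp : p.Prime) :
    Summable fun i : ℕ => ((p : ℝ) ^ (i + 1))⁻¹ := by
  have h1 : (1 : ℝ) < p := by exact_mod_cast hp.one_lt
  have : Summable fun i : ℕ => ((p : ℝ)⁻¹) ^ i :=
    summable_geometric_of_lt_one (by positivity) (inv_lt_one_of_one_lt₀ h1)
  simpa [inv_pow] using (summable_nat_add_iff 1).2 this

theorem one_sub_inv_prime_pow_succ_pos {p : ℕ} (hp : p.Prime) (i : ℕ) :
    0 < 1 - ((p : ℝ) ^ (i + 1))⁻¹ := by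
  have h1 : (1 : ℝ) < p := by exact_mod_cast hp.one_lt
  have := inv_lt_one_of_one_lt₀ (one_lt_pow₀ h1 (Nat.succ_ne_zero i))
  simpa using this

theorem tendsto_prod_cInfty {p : ℕ} (hp : p.Prime) :
    Tendsto (fun n => ∏ i ∈ Finset.range n, (1 - ((p : ℝ) ^ (i + 1))⁻¹)) atTop
      (𝓝 (cInfty p)) := by
  have h : Multipliable fun i : ℕ => 1 + -((p : ℝ) ^ (i + 1))⁻¹ :=
    Real.multipliable_one_add_of_summable (summable_inv_prime_pow_succ hp).neg
  simpa only [cInfty, ← sub_eq_add_neg] using h.hasProd.tendsto_prod_nat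

theorem cInfty_pos {p : ℕ} (hp : p.Prime) : 0 < cInfty p := by
  refine lt_of_le_of_ne (ge_of_tendsto' (tendsto_prod_cInfty hp) fun n =>
    Finset.prod_nonneg fun i _ => (one_sub_inv_prime_pow_succ_pos hp i).le) (Ne.symm ?_)
  have h := tprod_one_add_ne_zero_of_summable (f := fun i : ℕ => -((p : ℝ) ^ (i + 1))⁻¹)
    (fun i => by
      rw [← sub_eq_add_neg]
      exact (one_sub_inv_prime_pow_succ_pos hp i).ne')
    (by simpa using (summable_inv_prime_pow_succ hp).norm)
  simpa only [cInfty, ← sub_eq_add_neg] using h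

end

/-! ### Setwise limits of almost increasing sequences of measures -/

/-- The supremum of an increasing sequence of measures is a measure. -/
theorem MeasureTheory.Measure.exists_eq_iSup_of_monotone {X : Type*} [MeasurableSpace X]
    {m : ℕ → Measure X} (hm : ∀ S, MeasurableSet S → Monotone fun n => m n S) :
    ∃ ν : Measure X, ∀ S, MeasurableSet S → ν S = ⨆ n, m n S := by
  refine ⟨Measure.ofMeasurable (fun S _ => ⨆ n, m n S) (by simp) ?_, fun S hS =>
    Measure.ofMeasurable_apply S hS⟩
  intro f hf hd
  simp only [measure_iUnion hd hf, ENNReal.tsum_eq_iSup_sum]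
  rw [iSup_comm]
  refine iSup_congr fun s => ?_
  rw [ENNReal.finsetSum_iSup_of_monotone fun i => hm _ (hf i)]

/-- If `μ_{n+1} ≥ e_n μ_n` and the product of the `e_n` converges to a nonzero limit, then the
`μ_n` converge on every measurable set: after division by the partial products, they increase. -/
theorem MeasureTheory.exists_tendsto_of_mul_le {X : Type*} [MeasurableSpace X]
    {μ : ℕ → Measure X} (hμ : ∀ n, IsProbabilityMeasure (μ n)) {e : ℕ → ENNReal} {c : ENNReal}
    (he : ∀ n, e n ≠ 0) (he' : ∀ n, e n ≠ ⊤) (hc : c ≠ 0) (hc' : c ≠ ⊤)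
    (hec : Tendsto (fun n => ∏ i ∈ Finset.range n, e i) atTop (𝓝 c))
    (h : ∀ n S, MeasurableSet S → e n * μ n S ≤ μ (n + 1) S) :
    ∃ ν : Measure X, IsProbabilityMeasure ν ∧
      ∀ S, MeasurableSet S → Tendsto (fun n => μ n S) atTop (𝓝 (ν S)) := by
  let a : ℕ → ENNReal := fun n => ∏ i ∈ Finset.range n, e i
  have ha : ∀ n, a n ≠ 0 := fun n => Finset.prod_ne_zero_iff.2 fun i _ => he i
  have ha' : ∀ n, a n ≠ ⊤ := fun n => ENNReal.prod_ne_top fun i _ => he' i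
  have hmono : ∀ S, MeasurableSet S → Monotone fun n => ((a n)⁻¹ • μ n) S := by
    intro S hS
    refine monotone_nat_of_le_succ fun n => ?_
    simp only [Measure.smul_apply, smul_eq_mul]
    have : (a n)⁻¹ = (a (n + 1))⁻¹ * e n := by
      simp only [a, Finset.prod_range_succ]
      rw [ENNReal.mul_inv (Or.inl (ha n)) (Or.inl (ha' n)), mul_assoc,
        ENNReal.inv_mul_cancel (he n) (he' n), mul_one]
    rw [this, mul_assoc]
    gcongr
    exact h n S hS
  obtain ⟨ν, hν⟩ := Measure.exists_eq_iSup_of_monotone hmono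
  -- `c • ν` is the limit, where `ν` is the supremum of the normalized measures
  have key : ∀ S, MeasurableSet S → Tendsto (fun n => μ n S) atTop (𝓝 ((c • ν) S)) := by
    intro S hS
    have h1 : Tendsto (fun n => ((a n)⁻¹ • μ n) S) atTop (𝓝 (ν S)) := by
      rw [hν S hS]
      exact tendsto_atTop_iSup (hmono S hS)
    have h2 := ENNReal.Tendsto.mul hec (Or.inl hc) h1 (Or.inr hc')
    refine h2.congr fun n => ?_
    change a n * ((a n)⁻¹ * μ n S) = μ n S
    rw [← mul_assoc, ENNReal.mul_inv_cancel (ha n) (ha' n), one_mul]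
  refine ⟨c • ν, ⟨?_⟩, key⟩
  have h1 := key _ MeasurableSet.univ
  have : (fun n => μ n Set.univ) = fun _ => 1 := funext fun n => measure_univ
  rw [this] at h1
  exact tendsto_nhds_unique h1 tendsto_const_nhds |>.symm ▸ rfl

/-! ### Existence of the limit measure -/

section

variable {p n m : ℕ} [hp : Fact p.Prime]

theorem isProbabilityMeasure_schMeasure (h2 : 2 < p) : IsProbabilityMeasure (schMeasure p n) := by
  have := isProbabilityMeasure_oddHaar (n := n) h2
  exact Measure.isProbabilityMeasure_map (continuous_Theta p n).measurable.aemeasurable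

theorem schMeasure_apply {S : Set (Sch p)} (hS : MeasurableSet S) :
    schMeasure p n S = (Measure.pi fun _ : Fin n => oddHaar p n) (Theta p n ⁻¹' S) :=
  Measure.map_apply (continuous_Theta p n).measurable hS

/-- Dividing out one relation first, by a homomorphism onto a free group of smaller rank. -/
theorem Theta_cons_eq {s : OddPart (FreeProP p (n + 1))}
    {β : FreeProP p (n + 1) →* FreeProP p n} (hc : Continuous β) (hs : Function.Surjective β)
    (hβ : ∀ x, β (sigma x) = sigma (β x))
    (hker : β.ker = (Subgroup.normalClosure {(s : FreeProP p (n + 1))}).topologicalClosure)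
    (r : Fin n → OddPart (FreeProP p (n + 1))) :
    Theta p (n + 1) (Fin.cons s r) = Theta p n fun i => oddMap β hβ (r i) := by
  set t : OddTuple p (n + 1) := Fin.cons s r with ht
  set u : OddTuple p n := fun i => oddMap β hβ (r i) with hu
  have hts : (s : FreeProP p (n + 1)) ∈ relSubgroup t := mem_relSubgroup t 0
  have htr : ∀ i, (r i : FreeProP p (n + 1)) ∈ relSubgroup t := fun i => mem_relSubgroup t i.succ
  have hmem : ∀ i, β (r i) ∈ relSubgroup u := fun i => mem_relSubgroup u i
  have hβs : β s = 1 := by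
    rw [← MonoidHom.mem_ker, hker]
    exact Subgroup.le_topologicalClosure _ (Subgroup.subset_normalClosure rfl)
  rw [Theta_eq_iff]
  refine SigmaIso.nonempty_of_ker_eq (QuotientGroup.mk' (relSubgroup t))
    ((QuotientGroup.mk' (relSubgroup u)).comp β) QuotientGroup.continuous_mk
    (QuotientGroup.continuous_mk.comp hc) (QuotientGroup.mk'_surjective _)
    ((QuotientGroup.mk'_surjective _).comp hs) (fun _ => rfl) ?_ ?_
  · intro x
    rw [MonoidHom.comp_apply, hβ]
    rfl
  · rw [QuotientGroup.ker_mk', ← MonoidHom.comap_ker, QuotientGroup.ker_mk']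
    apply le_antisymm
    · refine relSubgroup_le ((Subgroup.isClosed_topologicalClosure _).preimage hc) fun i => ?_
      rw [Subgroup.mem_comap]
      refine Fin.cases ?_ (fun i => ?_) i
      · change β s ∈ _
        rw [hβs]
        exact one_mem _
      · exact hmem i
    · intro x hx
      have hle : relSubgroup u ≤ (relSubgroup t).map β := by
        have : ((relSubgroup t).map β).Normal := Subgroup.Normal.map inferInstance β hs
        refine relSubgroup_le
          ((Subgroup.isClosed_topologicalClosure _).isCompact.image hc).isClosed fun i => ?_
        exact ⟨r i, htr i, rfl⟩
      obtain ⟨y, hy, hxy⟩ := hle hx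
      have h1 : y⁻¹ * x ∈ β.ker := by
        rw [MonoidHom.mem_ker, map_mul, map_inv, hxy, inv_mul_cancel]
      have h3 : β.ker ≤ relSubgroup t := by
        rw [hker]
        exact Subgroup.topologicalClosure_minimal _
          (Subgroup.normalClosure_le_normal (by simpa using hts))
          (Subgroup.isClosed_topologicalClosure _)
      simpa using mul_mem hy (h3 h1)

/-- Conditionally on one relation being nontrivial modulo `p`, the measure `μ_{n+1}` is `μ_n`. -/
theorem mul_schMeasure_le (h2 : 2 < p) {S : Set (Sch p)} (hS : MeasurableSet S) :
    (1 - ((p : ENNReal) ^ (n + 1))⁻¹) * schMeasure p n S ≤ schMeasure p (n + 1) S := by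
  have hprob := isProbabilityMeasure_oddHaar (n := n + 1) h2
  have hprob' := isProbabilityMeasure_oddHaar (n := n) h2
  have hp1 : ∃ k, p = p ^ k := ⟨1, (pow_one p).symm⟩
  set T : Set (OddPart (FreeProP p (n + 1))) :=
    {s | abMap hp1 (s : FreeProP p (n + 1)) = 1} with hT
  have hTm : MeasurableSet T := ((isOpen_discrete {1}).preimage
    ((continuous_abMap hp1).comp continuous_subtype_val)).measurableSet
  have hTc : oddHaar p (n + 1) Tᶜ = 1 - ((p : ENNReal) ^ (n + 1))⁻¹ := by
    rw [prob_compl_eq_one_sub hTm, hT, oddHaar_abMap_fiber h2 hp1]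
  have hpres := (measurePreserving_piFinSuccAbove (fun _ : Fin (n + 1) => oddHaar p (n + 1)) 0)
  have hmS : MeasurableSet (Theta p (n + 1) ⁻¹' S) := (continuous_Theta p (n + 1)).measurable hS
  have h1 : schMeasure p (n + 1) S = ((oddHaar p (n + 1)).prod
      (Measure.pi fun _ : Fin n => oddHaar p (n + 1)))
        ((MeasurableEquiv.piFinSuccAbove (fun _ => OddPart (FreeProP p (n + 1))) 0).symm ⁻¹'
          (Theta p (n + 1) ⁻¹' S)) := by
    rw [schMeasure_apply hS]
    exact ((MeasurePreserving.symm _ hpres).measure_preimage_equiv _).symm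
  rw [h1, Measure.prod_apply ((MeasurableEquiv.measurable _) hmS)]
  refine le_trans ?_ (setLIntegral_le_lintegral Tᶜ _)
  rw [← hTc, mul_comm, ← setLIntegral_const]
  -- fibrewise over a relation `s` that is nontrivial modulo `p`
  refine setLIntegral_mono' hTm.compl fun s hs => ?_
  obtain ⟨β, hc, hsurj, hβ, hker⟩ := exists_hom_ker_eq_of_abMap_ne_one hp1 s hs
  have hp3 := measurePreserving_pi (fun _ : Fin n => oddHaar p (n + 1))
    (fun _ : Fin n => oddHaar p n) fun _ => measurePreserving_oddMap h2 hc hsurj hβ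
  rw [schMeasure_apply hS,
    ← hp3.measure_preimage ((continuous_Theta p n).measurable hS).nullMeasurableSet]
  refine le_of_eq (congrArg _ ?_)
  ext r
  simp only [Set.mem_preimage]
  rw [← Theta_cons_eq hc hsurj hβ hker r]
  simp only [MeasurableEquiv.piFinSuccAbove_symm_apply, Fin.insertNthEquiv_zero]
  rfl

theorem exists_isSchLimit (h2 : 2 < p) : ∃ ν, IsSchLimit p ν := by
  have hp' := hp.out
  have heq : ∀ n : ℕ, 1 - ((p : ENNReal) ^ (n + 1))⁻¹ =
      ENNReal.ofReal (1 - ((p : ℝ) ^ (n + 1))⁻¹) := by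
    intro n
    have : (0 : ℝ) < (p : ℝ) ^ (n + 1) := by have := hp'.pos; positivity
    rw [ENNReal.ofReal_sub _ (by positivity), ENNReal.ofReal_one, ENNReal.ofReal_inv_of_pos this,
      ENNReal.ofReal_pow (by positivity), ENNReal.ofReal_natCast]
  have hlim : Tendsto (fun n => ∏ i ∈ Finset.range n,
      ENNReal.ofReal (1 - ((p : ℝ) ^ (i + 1))⁻¹)) atTop (𝓝 (ENNReal.ofReal (cInfty p))) := by
    refine (ENNReal.tendsto_ofReal (tendsto_prod_cInfty hp')).congr fun n => ?_
    exact ENNReal.ofReal_prod_of_nonneg fun i _ => (one_sub_inv_prime_pow_succ_pos hp' i).le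
  obtain ⟨ν, hν, h⟩ := exists_tendsto_of_mul_le (μ := fun n => schMeasure p n)
    (fun n => isProbabilityMeasure_schMeasure h2)
    (fun n => (ENNReal.ofReal_pos.2 (one_sub_inv_prime_pow_succ_pos hp' n)).ne')
    (fun n => ENNReal.ofReal_ne_top)
    (ENNReal.ofReal_pos.2 (cInfty_pos hp')).ne' ENNReal.ofReal_ne_top hlim fun n S hS => by
      rw [← heq]
      exact mul_schMeasure_le h2 hS
  exact ⟨ν, hν, h⟩

theorem isSchLimit_schMeasureInfty (h2 : 2 < p) : IsSchLimit p (schMeasureInfty p) := by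
  have h := exists_isSchLimit h2
  rw [schMeasureInfty, dif_pos h]
  exact h.choose_spec

end

/-! ### Abelianizations modulo `q`-th powers -/

/-- `G_ab` modulo `q`-th powers. -/
abbrev AbModPow (q : ℕ) (G : Type*) [Group G] [TopologicalSpace G] [IsTopologicalGroup G] :
    Type _ :=
  TopologicalAbelianization G ⧸
    (powMonoidHom q : TopologicalAbelianization G →* TopologicalAbelianization G).range

namespace AbModPow

section

variable (q : ℕ) (G : Type*) [Group G] [TopologicalSpace G] [IsTopologicalGroup G]

/-- The projection `G → G_ab / q`. -/
def mk : G →* AbModPow q G :=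
  (QuotientGroup.mk' _).comp (QuotientGroup.mk' (commutator G).topologicalClosure)

theorem continuous_mk : Continuous (mk q G) :=
  QuotientGroup.continuous_mk.comp QuotientGroup.continuous_mk

theorem mk_surjective : Function.Surjective (mk q G) :=
  (QuotientGroup.mk'_surjective _).comp (QuotientGroup.mk'_surjective _)

instance : IsClosed ((commutator G).topologicalClosure : Set G) :=
  Subgroup.isClosed_topologicalClosure _

instance [CompactSpace G] : IsClosed
    ((powMonoidHom q : TopologicalAbelianization G →* TopologicalAbelianization G).range :
      Set (TopologicalAbelianization G)) :=
  (isCompact_range (continuous_pow q)).isClosed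

theorem pow_eq_one (x : AbModPow q G) : x ^ q = 1 := by
  obtain ⟨y, rfl⟩ := QuotientGroup.mk_surjective x
  exact (QuotientGroup.eq_one_iff _).2 ⟨y, rfl⟩

variable {q G}

/-- The universal property of `G_ab / q`. -/
theorem exists_lift {B : Type*} [CommGroup B] [TopologicalSpace B] [T1Space B]
    (hB : ∀ b : B, b ^ q = 1) (f : G →* B) (hf : Continuous f) :
    ∃ g : AbModPow q G →* B, ∀ x, g (mk q G x) = f x := by
  have h1 : (commutator G).topologicalClosure ≤ f.ker :=
    Subgroup.topologicalClosure_minimal _ (Abelianization.commutator_subset_ker f)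
      (isClosed_singleton.preimage hf)
  let f1 : TopologicalAbelianization G →* B := QuotientGroup.lift _ f h1
  have h2 : (powMonoidHom q : TopologicalAbelianization G →* _).range ≤ f1.ker := by
    rintro _ ⟨y, rfl⟩
    change f1 (y ^ q) = 1
    rw [map_pow, hB]
  exact ⟨QuotientGroup.lift _ f1 h2, fun x => rfl⟩

end

end AbModPow

/-- The `p ^ k`-th dimension subgroup of an abelian group consists of limits of `p ^ k`-th
powers. -/
theorem zassenhaus_pow_eq_bot {p : ℕ} [hp : Fact p.Prime] {B : Type*} [CommGroup B]
    [TopologicalSpace B] [IsTopologicalGroup B] [T1Space B] {k : ℕ} (hB : ∀ b : B, b ^ p ^ k = 1) :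
    zassenhaus p B (p ^ k) = ⊥ := by
  have key : ∀ j ≤ k, ∀ x ∈ zassenhaus p B (p ^ j), x ^ p ^ (k - j) = 1 := by
    intro j
    induction j with
    | zero => intro _ x _; exact hB x
    | succ j ih =>
      intro hj x hx
      have hlt : 1 < p ^ (j + 1) := Nat.one_lt_pow (Nat.succ_ne_zero j) hp.out.one_lt
      have hdiv : (p ^ (j + 1) + p - 1) / p = p ^ j := by
        have h1 := hp.out.pos
        rw [pow_succ, Nat.add_sub_assoc h1, mul_comm, Nat.mul_add_div h1,
          Nat.div_eq_of_lt (by omega), add_zero]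
      rw [zassenhaus_of_one_lt p B hlt, hdiv] at hx
      have hle : (Subgroup.closure {y | ∃ x ∈ zassenhaus p B (p ^ j), x ^ p = y} ⊔
          ⨆ i : {i : ℕ // 0 < i ∧ i < p ^ (j + 1)},
            ⁅zassenhaus p B i.1, zassenhaus p B (p ^ (j + 1) - i.1)⁆).topologicalClosure ≤
          (powMonoidHom (p ^ (k - (j + 1))) : B →* B).ker := by
        refine Subgroup.topologicalClosure_minimal _ (sup_le ?_ (iSup_le fun i => ?_))
          (isClosed_singleton.preimage (continuous_pow _))
        · rw [Subgroup.closure_le]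
          rintro _ ⟨x, hx, rfl⟩
          change (x ^ p) ^ p ^ (k - (j + 1)) = 1
          rw [← pow_mul, ← pow_succ', show k - (j + 1) + 1 = k - j by omega]
          exact ih (by omega) x hx
        · rw [Subgroup.commutator_le]
          intro x _ y _
          rw [commutatorElement_eq_one_iff_mul_comm.2 (mul_comm x y)]
          exact one_mem _
      exact hle hx
  rw [eq_bot_iff]
  intro x hx
  simpa using key k le_rfl x hx

theorem nonempty_mulEquiv_of_surjective {X Y : Type*} [Group X] [Group Y] [Finite X] [Finite Y]
    {f : X →* Y} {g : Y →* X} (hf : Function.Surjective f) (hg : Function.Surjective g) :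
    Nonempty (X ≃* Y) := by
  have h : Nat.card X = Nat.card Y :=
    le_antisymm (Nat.card_le_card_of_surjective g hg) (Nat.card_le_card_of_surjective f hf)
  exact ⟨MulEquiv.ofBijective f ((Nat.bijective_iff_surjective_and_card f).2 ⟨hf, h⟩)⟩

/-- A continuous homomorphism from a quotient `G / D_{p^k}(G)` to `H / D_{p^k}(H)` induces a
homomorphism of abelianizations modulo `p ^ k`. -/
theorem AbModPow.exists_surjective {p : ℕ} [Fact p.Prime] {k : ℕ} {G H : Type*}
    [Group G] [TopologicalSpace G] [IsTopologicalGroup G]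
    [Group H] [TopologicalSpace H] [IsTopologicalGroup H] [CompactSpace H]
    (e : G ⧸ zassenhaus p G (p ^ k) →* H ⧸ zassenhaus p H (p ^ k)) (he : Continuous e)
    (hs : Function.Surjective e) :
    ∃ f : AbModPow (p ^ k) G →* AbModPow (p ^ k) H, Function.Surjective f := by
  have hle : zassenhaus p H (p ^ k) ≤ (mk (p ^ k) H).ker := by
    refine (zassenhaus_le_comap p _ (continuous_mk (p ^ k) H) _).trans ?_
    rw [zassenhaus_pow_eq_bot (AbModPow.pow_eq_one (p ^ k) H)]
    exact le_of_eq rfl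
  let π : H ⧸ zassenhaus p H (p ^ k) →* AbModPow (p ^ k) H := QuotientGroup.lift _ _ hle
  have hπ : Continuous π := continuous_quot_lift _ (continuous_mk (p ^ k) H)
  have hπs : Function.Surjective π := fun x => by
    obtain ⟨y, rfl⟩ := mk_surjective (p ^ k) H x
    exact ⟨QuotientGroup.mk y, rfl⟩
  obtain ⟨f, hf⟩ := exists_lift (AbModPow.pow_eq_one (p ^ k) H)
    (π.comp (e.comp (QuotientGroup.mk' (zassenhaus p G (p ^ k)))))
    (hπ.comp (he.comp QuotientGroup.continuous_mk))
  refine ⟨f, fun x => ?_⟩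
  obtain ⟨y, rfl⟩ := (hπs.comp (hs.comp (QuotientGroup.mk'_surjective _))) x
  exact ⟨mk _ _ y, hf y⟩

/-- The universal property of the free `ℤ/q`-module on `n` generators, written
multiplicatively. -/
theorem exists_hom_of_pow_eq_one {n q : ℕ} {C : Type*} [CommGroup C] (hC : ∀ x : C, x ^ q = 1)
    (c : Fin n → C) :
    ∃ L : Multiplicative (Fin n → ZMod q) →* C,
      ∀ i, L (Multiplicative.ofAdd (Pi.single i 1)) = c i := by
  let l (i : Fin n) : ZMod q →+ Additive C :=
    ZMod.lift q ⟨zmultiplesHom (Additive C) (Additive.ofMul (c i)), by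
      simp [← ofMul_pow, hC]⟩
  let L : (Fin n → ZMod q) →+ Additive C :=
    ∑ i, (l i).comp (Pi.evalAddMonoidHom (fun _ : Fin n => ZMod q) i)
  refine ⟨AddMonoidHom.toMultiplicativeLeft L, fun i => ?_⟩
  change Additive.toMul (L (Pi.single i 1)) = c i
  have h1 : l i 1 = Additive.ofMul (c i) := by
    have := ZMod.lift_coe q ⟨zmultiplesHom (Additive C) (Additive.ofMul (c i)), by
      simp [← ofMul_pow, hC]⟩ 1
    simpa using this
  have : L (Pi.single i 1) = l i 1 := by
    simp only [L, AddMonoidHom.finsetSum_apply, AddMonoidHom.comp_apply, Pi.evalAddMonoidHom_apply]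
    rw [Finset.sum_eq_single i]
    · simp
    · intro j _ hj
      simp [Pi.single_eq_of_ne hj]
    · simp
  rw [this, h1]
  rfl

section

variable {p n m : ℕ} [hp : Fact p.Prime]

/-- The image of a tuple of relations in `(ℤ/q)^n`. -/
noncomputable def relMod {q : ℕ} (hq : ∃ k, q = p ^ k) (r : OddTuple p n) :
    Fin n → Multiplicative (Fin n → ZMod q) := fun i => abMap hq (r i : FreeProP p n)

/-- The quotient of `(ℤ/q)^n` by the images of the relations. -/
abbrev RelModQuotient {q : ℕ} (hq : ∃ k, q = p ^ k) (r : OddTuple p n) : Type :=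
  Multiplicative (Fin n → ZMod q) ⧸ Subgroup.closure (Set.range (relMod hq r))

theorem exists_abModPow_hom_relModQuotient {q : ℕ} (hq : ∃ k, q = p ^ k) (r : OddTuple p n) :
    ∃ f : AbModPow q (SchurGroup r) →* RelModQuotient hq r, Function.Surjective f := by
  have hM : ∀ x : RelModQuotient hq r, x ^ q = 1 := by
    intro x
    obtain ⟨v, rfl⟩ := QuotientGroup.mk_surjective x
    rw [← QuotientGroup.mk_pow]
    have : v ^ q = 1 := by
      apply Multiplicative.toAdd.injective
      rw [toAdd_pow]
      ext i
      simp
    rw [this]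
    rfl
  let f0 : FreeProP p n →* RelModQuotient hq r := (QuotientGroup.mk' _).comp (abMap hq)
  have hf0 : Continuous f0 := QuotientGroup.continuous_mk.comp (continuous_abMap hq)
  have hf0s : Function.Surjective f0 := (QuotientGroup.mk'_surjective _).comp (abMap_surjective hq)
  have hf0r : relSubgroup r ≤ f0.ker := by
    refine relSubgroup_le (isClosed_singleton.preimage hf0) fun i => ?_
    exact (QuotientGroup.eq_one_iff _).2 (Subgroup.subset_closure ⟨i, rfl⟩)
  have hf1 : Continuous (QuotientGroup.lift _ f0 hf0r) := continuous_quot_lift _ hf0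
  obtain ⟨f, hf⟩ : ∃ f : AbModPow q (SchurGroup r) →* RelModQuotient hq r,
      ∀ x, f (AbModPow.mk q (SchurGroup r) x) = QuotientGroup.lift _ f0 hf0r x :=
    AbModPow.exists_lift hM _ hf1
  refine ⟨f, fun x => ?_⟩
  obtain ⟨y, rfl⟩ := hf0s x
  exact ⟨AbModPow.mk q _ (QuotientGroup.mk y), hf _⟩

theorem exists_relModQuotient_hom_abModPow {q : ℕ} (hq : ∃ k, q = p ^ k) (r : OddTuple p n) :
    ∃ g : RelModQuotient hq r →* AbModPow q (SchurGroup r), Function.Surjective g := by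
  have : NeZero q := ⟨by
    obtain ⟨k, rfl⟩ := hq
    exact pow_ne_zero _ hp.out.ne_zero⟩
  let g0 : FreeProP p n →* AbModPow q (SchurGroup r) :=
    (AbModPow.mk q (SchurGroup r)).comp (QuotientGroup.mk' (relSubgroup r))
  have hmk : Continuous (QuotientGroup.mk' (relSubgroup r)) := QuotientGroup.continuous_mk
  have hg0 : Continuous g0 := (AbModPow.continuous_mk q (SchurGroup r)).comp hmk
  have hg0s : Function.Surjective g0 :=
    (AbModPow.mk_surjective q (SchurGroup r)).comp (QuotientGroup.mk'_surjective (relSubgroup r))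
  obtain ⟨L, hL⟩ := exists_hom_of_pow_eq_one (AbModPow.pow_eq_one q (SchurGroup r))
    fun i => g0 (gen p i)
  have hLg : L.comp (abMap hq) = g0 := by
    refine hom_ext ((continuous_of_discreteTopology (f := L)).comp (continuous_abMap hq)) hg0
      fun i => ?_
    rw [MonoidHom.comp_apply, abMap_gen, hL]
  have hLR : Subgroup.closure (Set.range (relMod hq r)) ≤ L.ker := by
    rw [Subgroup.closure_le]
    rintro _ ⟨i, rfl⟩
    change L.comp (abMap hq) (r i) = 1
    rw [hLg]
    have : QuotientGroup.mk' (relSubgroup r) (r i) = 1 :=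
      (QuotientGroup.eq_one_iff _).2 (mem_relSubgroup r i)
    rw [MonoidHom.comp_apply, this, map_one]
  refine ⟨QuotientGroup.lift _ L hLR, fun x => ?_⟩
  obtain ⟨y, rfl⟩ := hg0s x
  exact ⟨QuotientGroup.mk (abMap hq y), DFunLike.congr_fun hLg y⟩

theorem finite_abModPow {q : ℕ} (hq : ∃ k, q = p ^ k) (r : OddTuple p n) :
    Finite (AbModPow q (SchurGroup r)) := by
  have : NeZero q := ⟨by
    obtain ⟨k, rfl⟩ := hq
    exact pow_ne_zero _ hp.out.ne_zero⟩
  obtain ⟨g, hg⟩ := exists_relModQuotient_hom_abModPow hq r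
  have : Finite (Multiplicative (Fin n → ZMod q)) := inferInstance
  have : Finite (RelModQuotient hq r) := Quotient.finite _
  exact Finite.of_surjective g hg

/-- The abelianization of `G_r` modulo `q` is presented by the relations modulo `q`. -/
theorem nonempty_abModPow_mulEquiv {q : ℕ} (hq : ∃ k, q = p ^ k) (r : OddTuple p n) :
    Nonempty (AbModPow q (SchurGroup r) ≃* RelModQuotient hq r) := by
  have := finite_abModPow hq r
  obtain ⟨f, hf⟩ := exists_abModPow_hom_relModQuotient hq r
  obtain ⟨g, hg⟩ := exists_relModQuotient_hom_abModPow hq r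
  have : Finite (RelModQuotient hq r) := Finite.of_surjective f hf
  exact nonempty_mulEquiv_of_surjective hf hg

/-- The intersection of the groups of `p ^ k`-th powers in a quotient of `F_n` is trivial. -/
theorem eq_one_of_forall_exists_pow_eq {Q : Type*} [Group Q] [TopologicalSpace Q] [T1Space Q]
    {f : FreeProP p n →* Q} (hf : Continuous f) (hs : Function.Surjective f) {x : Q}
    (h : ∀ k, ∃ y : Q, y ^ p ^ k = x) : x = 1 := by
  by_contra hx
  have hU : {g | f g ≠ x} ∈ 𝓝 (1 : FreeProP p n) := by
    refine (isOpen_compl_singleton.preimage hf).mem_nhds ?_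
    simpa using Ne.symm hx
  obtain ⟨N, hN⟩ := exists_ker_proj_subset hU
  obtain ⟨k, hk⟩ := card_pQuot N
  obtain ⟨y, hy⟩ := h k
  obtain ⟨g, rfl⟩ := hs y
  refine hN (g ^ p ^ k) ?_ (by rw [map_pow, hy])
  rw [map_pow, ← hk, pow_card_eq_one']

/-- Nakayama's lemma: if `G_ab / p ^ (k + 1)` is killed by `p ^ k`, then so is `G_ab`. -/
theorem nonempty_mulEquiv_iff_abModPow {A : Type*} [CommGroup A] {k : ℕ}
    (hA : ∀ a : A, a ^ p ^ k = 1) (r : OddTuple p n) :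
    Nonempty (TopologicalAbelianization (SchurGroup r) ≃* A) ↔
      Nonempty (AbModPow (p ^ (k + 1)) (SchurGroup r) ≃* A) := by
  set Q := TopologicalAbelianization (SchurGroup r)
  have main : (∀ x : Q, x ^ p ^ (k + 1) = 1) →
      Nonempty (AbModPow (p ^ (k + 1)) (SchurGroup r) ≃* Q) := by
    intro h
    have hbot : (powMonoidHom (p ^ (k + 1)) : Q →* Q).range = ⊥ := by
      rw [eq_bot_iff]
      rintro _ ⟨x, rfl⟩
      exact h x
    exact ⟨(QuotientGroup.quotientMulEquivOfEq hbot).trans QuotientGroup.quotientBot⟩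
  constructor
  · rintro ⟨e⟩
    obtain ⟨f⟩ := main fun x => by
      apply e.injective
      rw [map_pow, pow_succ, pow_mul, hA, one_pow, map_one]
    exact ⟨f.trans e⟩
  · rintro ⟨e⟩
    -- every `p ^ k`-th power is a `p ^ (k + 1)`-th power, hence infinitely divisible by `p`
    have h1 : ∀ x : Q, ∃ y : Q, y ^ p ^ (k + 1) = x ^ p ^ k := by
      intro x
      have : (QuotientGroup.mk (x ^ p ^ k) : AbModPow (p ^ (k + 1)) (SchurGroup r)) = 1 := by
        apply e.injective
        rw [QuotientGroup.mk_pow, map_pow, hA, map_one]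
      exact (QuotientGroup.eq_one_iff _).1 this
    have h2 : ∀ (j : ℕ) (x : Q), ∃ y : Q, (y ^ p ^ k) ^ p ^ j = x ^ p ^ k := by
      intro j
      induction j with
      | zero => exact fun x => ⟨x, by simp⟩
      | succ j ih =>
        intro x
        obtain ⟨y, hy⟩ := ih x
        obtain ⟨z, hz⟩ := h1 y
        refine ⟨z, ?_⟩
        rw [← hy, ← hz, ← pow_mul, ← pow_mul]
        congr 1
        ring
    have h3 : ∀ x : Q, x ^ p ^ k = 1 := by
      intro x
      refine eq_one_of_forall_exists_pow_eq (p := p)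
        (f := (QuotientGroup.mk' (commutator (SchurGroup r)).topologicalClosure).comp
          (QuotientGroup.mk' (relSubgroup r)))
        (QuotientGroup.continuous_mk.comp QuotientGroup.continuous_mk)
        ((QuotientGroup.mk'_surjective _).comp (QuotientGroup.mk'_surjective _)) fun j => ?_
      obtain ⟨y, hy⟩ := h2 j x
      exact ⟨_, hy⟩
    obtain ⟨f⟩ := main fun x => by rw [pow_succ, pow_mul, h3, one_pow]
    exact ⟨f.symm.trans e⟩

/-- `D_{p^k}` dies in abelian groups killed by `p ^ k`. -/
theorem nonempty_abModPow_mulEquiv_of_sigmaIso {k : ℕ} {r : OddTuple p n} {s : OddTuple p m}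
    (e : SigmaIso (SchurGroup r ⧸ zassenhaus p (SchurGroup r) (p ^ k))
      (SchurGroup s ⧸ zassenhaus p (SchurGroup s) (p ^ k))) :
    Nonempty (AbModPow (p ^ k) (SchurGroup r) ≃* AbModPow (p ^ k) (SchurGroup s)) := by
  have hr := finite_abModPow (p := p) ⟨k, rfl⟩ r
  have hs := finite_abModPow (p := p) ⟨k, rfl⟩ s
  let φ := e.toContinuousMulEquiv
  obtain ⟨f, hf⟩ := AbModPow.exists_surjective φ.toMulEquiv.toMonoidHom φ.continuous φ.surjective
  obtain ⟨g, hg⟩ := AbModPow.exists_surjective φ.symm.toMulEquiv.toMonoidHom φ.symm.continuous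
    φ.symm.surjective
  exact nonempty_mulEquiv_of_surjective hf hg

variable {A : Type*} [CommGroup A] {k : ℕ} (hA : ∀ a : A, a ^ p ^ k = 1)

include hA in
/-- Membership of `[G]` in the set of classes with `G_ab ≅ A` depends only on `G / D_i(G)` for a
suitable `i`. -/
theorem mem_schAb_of_sigmaIso {r : OddTuple p n} {s : OddTuple p m}
    (e : SigmaIso (SchurGroup r ⧸ zassenhaus p (SchurGroup r) (p ^ (k + 1)))
      (SchurGroup s ⧸ zassenhaus p (SchurGroup s) (p ^ (k + 1))))
    (h : Nonempty (TopologicalAbelianization (SchurGroup s) ≃* A)) :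
    Nonempty (TopologicalAbelianization (SchurGroup r) ≃* A) := by
  rw [nonempty_mulEquiv_iff_abModPow hA] at h ⊢
  obtain ⟨f⟩ := h
  obtain ⟨g⟩ := nonempty_abModPow_mulEquiv_of_sigmaIso e
  exact ⟨g.trans f⟩

include hA in
theorem Theta_mem_schAb_iff {r : OddTuple p n} :
    Theta p n r ∈ schAb p A ↔ Nonempty (TopologicalAbelianization (SchurGroup r) ≃* A) := by
  constructor
  · rintro ⟨m, s, hs, h⟩
    obtain ⟨e⟩ := Theta_eq_iff.1 hs.symm
    obtain ⟨f⟩ := e.nonempty_zassenhaus_quotient (p := p) (p ^ (k + 1))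
    exact mem_schAb_of_sigmaIso hA f h
  · exact fun h => ⟨n, r, rfl, h⟩

omit hp in
theorem exists_Theta_eq (x : Sch p) : ∃ (n : ℕ) (r : OddTuple p n), Theta p n r = x := by
  obtain ⟨⟨n, r⟩, h⟩ := Quotient.exists_rep x
  exact ⟨n, r, h⟩

include hA in
theorem isClopen_schAb : IsClopen (schAb p A) := by
  have hi : 2 ≤ p ^ (k + 1) :=
    hp.out.two_le.trans (Nat.le_self_pow (Nat.succ_ne_zero k) p)
  have hnhd : ∀ (n : ℕ) (r : OddTuple p n), schNhd p (p ^ (k + 1)) r ∈ 𝓝 (Theta p n r) := by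
    intro n r
    refine IsOpen.mem_nhds (TopologicalSpace.isOpen_generateFrom_of_mem ⟨_, n, r, hi, rfl⟩) ?_
    exact Theta_mem_schNhd.2 ⟨SigmaIso.refl _⟩
  constructor
  · rw [← isOpen_compl_iff, isOpen_iff_mem_nhds]
    intro x hx
    obtain ⟨n, r, rfl⟩ := exists_Theta_eq x
    refine mem_of_superset (hnhd n r) fun y hy => ?_
    obtain ⟨m, s, rfl⟩ := exists_Theta_eq y
    obtain ⟨e⟩ := Theta_mem_schNhd.1 hy
    intro hs
    exact hx ((Theta_mem_schAb_iff hA).2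
      (mem_schAb_of_sigmaIso hA e.symm ((Theta_mem_schAb_iff hA).1 hs)))
  · rw [isOpen_iff_mem_nhds]
    intro x hx
    obtain ⟨n, r, rfl⟩ := exists_Theta_eq x
    refine mem_of_superset (hnhd n r) fun y hy => ?_
    obtain ⟨m, s, rfl⟩ := exists_Theta_eq y
    obtain ⟨e⟩ := Theta_mem_schNhd.1 hy
    exact (Theta_mem_schAb_iff hA).2
      (mem_schAb_of_sigmaIso hA e ((Theta_mem_schAb_iff hA).1 hx))

end

/-! ### Counting generating tuples of finite abelian `p`-groups -/

section

/-- The number of `n`-tuples of elements of `K` that generate `K`. -/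
noncomputable def genCount (n : ℕ) (K : Type*) [Group K] : ℕ :=
  Nat.card {t : Fin n → K // Subgroup.closure (Set.range t) = ⊤}

/-- Tuples in `M` that generate the subgroup `K`. -/
theorem card_closure_eq (n : ℕ) {M : Type*} [Group M] (K : Subgroup M) :
    Nat.card {t : Fin n → M // Subgroup.closure (Set.range t) = K} = genCount n K := by
  have hmap : ∀ t : Fin n → K, Subgroup.closure (Set.range fun i => (t i : M)) =
      (Subgroup.closure (Set.range t)).map K.subtype := by
    intro t
    rw [MonoidHom.map_closure, ← Set.range_comp]
    rfl
  refine (Nat.card_eq_of_bijective (fun t : {t : Fin n → K //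
    Subgroup.closure (Set.range t) = ⊤} => (⟨fun i => (t.1 i : M), ?_⟩ :
      {t : Fin n → M // Subgroup.closure (Set.range t) = K})) ⟨?_, ?_⟩).symm
  · rw [hmap, t.2, ← MonoidHom.range_eq_map, K.range_subtype]
  · intro t u h
    apply Subtype.ext
    funext i
    exact Subtype.ext (congrFun (congrArg Subtype.val h) i)
  · rintro ⟨t, ht⟩
    have hmem : ∀ i, t i ∈ K := fun i => ht ▸ Subgroup.subset_closure ⟨i, rfl⟩
    refine ⟨⟨fun i => ⟨t i, hmem i⟩, ?_⟩, rfl⟩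
    apply Subgroup.map_injective K.subtype_injective
    rw [← hmap, ← MonoidHom.range_eq_map, K.range_subtype]
    exact ht

theorem card_preimage_mul_card {G H : Type*} [Group G] [Group H] [Finite G] (f : G →* H)
    (hf : Function.Surjective f) (P : H → Prop) :
    Nat.card {x : G // P (f x)} * Nat.card H = Nat.card {y : H // P y} * Nat.card G := by
  have : Finite H := Finite.of_surjective f hf
  choose s hs using hf
  let e : {x : G // P (f x)} ≃ {y : H // P y} × f.ker :=
    { toFun := fun x => (⟨f x, x.2⟩, ⟨(s (f x))⁻¹ * x, by simp [MonoidHom.mem_ker, hs]⟩)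
      invFun := fun y => ⟨s y.1 * y.2, by
        rw [map_mul, hs, MonoidHom.mem_ker.1 y.2.2, mul_one]
        exact y.1.2⟩
      left_inv := fun x => Subtype.ext (by simp)
      right_inv := fun y => by
        have : f (s y.1 * y.2) = y.1 := by
          rw [map_mul, hs, MonoidHom.mem_ker.1 y.2.2, mul_one]
        refine Prod.ext (Subtype.ext this) (Subtype.ext ?_)
        simp [this] }
  have hG : Nat.card G = Nat.card H * Nat.card f.ker := by
    rw [← Subgroup.card_mul_index f.ker, Subgroup.index_ker,
      MonoidHom.range_eq_top.2 (fun y => ⟨s y, hs y⟩), Subgroup.card_top, mul_comm]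
  rw [Nat.card_congr e, Nat.card_prod, hG]
  ring

variable {p : ℕ} [hp : Fact p.Prime]

/-- Frattini: generation of a finite abelian `p`-group can be tested modulo `p`-th powers. -/
theorem closure_range_eq_top_iff {n : ℕ} {K : Type*} [CommGroup K] [Finite K] (hK : IsPGroup p K)
    (t : Fin n → K) :
    Subgroup.closure (Set.range t) = ⊤ ↔
      Subgroup.closure (Set.range fun i =>
        (QuotientGroup.mk' (powMonoidHom p : K →* K).range) (t i)) = ⊤ := by
  set π := QuotientGroup.mk' (powMonoidHom p : K →* K).range
  have hmap : Subgroup.closure (Set.range fun i => π (t i)) =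
      (Subgroup.closure (Set.range t)).map π := by
    rw [MonoidHom.map_closure, ← Set.range_comp]
    rfl
  rw [hmap]
  constructor
  · intro h
    rw [h, ← MonoidHom.range_eq_map, MonoidHom.range_eq_top]
    exact QuotientGroup.mk'_surjective _
  · intro h
    by_contra hne
    obtain ⟨χ, hχ, hle⟩ := hK.exists_hom_zmod_of_ne_top hne
    have hker : π.ker ≤ χ.ker := by
      rw [QuotientGroup.ker_mk']
      rintro _ ⟨x, rfl⟩
      change χ (x ^ p) = 1
      rw [map_pow]
      apply Multiplicative.toAdd.injective
      simp
    apply hχ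
    have htop : χ.ker = ⊤ := by
      rw [eq_top_iff]
      intro x _
      have hx : π x ∈ (Subgroup.closure (Set.range t)).map π := h ▸ Subgroup.mem_top _
      obtain ⟨y, hy, hxy⟩ := hx
      have h1 : y⁻¹ * x ∈ π.ker := by
        rw [MonoidHom.mem_ker, map_mul, map_inv, hxy, inv_mul_cancel]
      simpa using mul_mem (hle hy) (hker h1)
    exact MonoidHom.ker_eq_top_iff.1 htop

/-- The number of bases of an elementary abelian group of order `p ^ n`. -/
theorem genCount_elementary {n : ℕ} {V : Type*} [CommGroup V] [Finite V] (hV : ∀ x : V, x ^ p = 1)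
    (hcard : Nat.card V = p ^ n) :
    genCount n V = ∏ i : Fin n, (p ^ n - p ^ i.val) := by
  let _ : Module (ZMod p) (Additive V) := AddCommGroup.zmodModule (n := p) fun x => hV x.toMul
  have hfin : Module.finrank (ZMod p) (Additive V) = n := by
    have h := Module.natCard_eq_pow_finrank (K := ZMod p) (V := Additive V)
    rw [Nat.card_zmod] at h
    exact Nat.pow_right_injective hp.out.two_le (h.symm.trans hcard)
  have h := card_linearIndependent (K := ZMod p) (V := Additive V) (k := n) hfin.ge
  rw [hfin, ZMod.card] at h
  rw [← h, genCount]
  refine Nat.card_congr (Equiv.subtypeEquiv (Equiv.arrowCongr (Equiv.refl _) Additive.ofMul) ?_)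
  intro t
  let s : Fin n → Additive V := fun i => Additive.ofMul (t i)
  change _ ↔ LinearIndependent (ZMod p) s
  have hspan : LinearIndependent (ZMod p) s ↔ Submodule.span (ZMod p) (Set.range s) = ⊤ := by
    constructor
    · intro hl
      exact hl.span_eq_top_of_card_eq_finrank' (by simp [hfin])
    · intro hs
      exact linearIndependent_of_top_le_span_of_card_eq_finrank hs.ge (by simp [hfin])
  rw [hspan]
  constructor
  · intro hc
    rw [eq_top_iff]
    intro x _
    have hx : x.toMul ∈ Subgroup.closure (Set.range t) := hc ▸ Subgroup.mem_top _
    have : ∀ y ∈ Subgroup.closure (Set.range t),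
        Additive.ofMul y ∈ Submodule.span (ZMod p) (Set.range s) := by
      intro y hy
      induction hy using Subgroup.closure_induction with
      | mem y hy =>
        obtain ⟨i, rfl⟩ := hy
        exact Submodule.subset_span ⟨i, rfl⟩
      | one => exact zero_mem _
      | mul _ _ _ _ h1 h2 => exact add_mem h1 h2
      | inv _ _ h1 => exact neg_mem h1
    exact this _ hx
  · intro hs
    rw [eq_top_iff]
    intro x _
    have hx : Additive.ofMul x ∈ Submodule.span (ZMod p) (Set.range s) := hs ▸ Submodule.mem_top
    have : ∀ y ∈ Submodule.span (ZMod p) (Set.range s),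
        y.toMul ∈ Subgroup.closure (Set.range t) := by
      intro y hy
      induction hy using Submodule.span_induction with
      | mem y hy =>
        obtain ⟨i, rfl⟩ := hy
        exact Subgroup.subset_closure ⟨i, rfl⟩
      | zero => exact one_mem _
      | add _ _ _ _ h1 h2 => exact mul_mem h1 h2
      | smul a y _ h1 =>
        have : a • y = a.val • y := by
          rw [← Nat.cast_smul_eq_nsmul (ZMod p), ZMod.natCast_zmod_val]
        rw [this]
        exact pow_mem h1 _
    exact this _ hx

/-- A tuple generates `K` if and only if it reduces to a basis of `K / pK`. -/
theorem genCount_of_card_quotient {n : ℕ} {K : Type*} [CommGroup K] [Finite K]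
    (hK : IsPGroup p K) (hcard : Nat.card (K ⧸ (powMonoidHom p : K →* K).range) = p ^ n) :
    (genCount n K : ℝ) =
      (Nat.card K : ℝ) ^ n * ∏ i ∈ Finset.range n, (1 - ((p : ℝ) ^ (i + 1))⁻¹) := by
  set V := K ⧸ (powMonoidHom p : K →* K).range
  set π : K →* V := QuotientGroup.mk' (powMonoidHom p : K →* K).range
  have hV : ∀ x : V, x ^ p = 1 := by
    intro x
    obtain ⟨y, rfl⟩ := QuotientGroup.mk_surjective x
    exact (QuotientGroup.eq_one_iff _).2 ⟨y, rfl⟩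
  have hgen := genCount_elementary hV hcard
  let πn : (Fin n → K) →* (Fin n → V) := MonoidHom.pi fun i => π.comp (Pi.evalMonoidHom _ i)
  have hπn : Function.Surjective πn := by
    intro v
    choose t ht using fun i => QuotientGroup.mk'_surjective (powMonoidHom p : K →* K).range (v i)
    exact ⟨t, funext ht⟩
  have h1 := card_preimage_mul_card πn hπn fun v => Subgroup.closure (Set.range v) = ⊤
  have h2 : Nat.card {t : Fin n → K // Subgroup.closure (Set.range (πn t)) = ⊤} =
      genCount n K :=
    Nat.card_congr (Equiv.subtypeEquivRight fun t => (closure_range_eq_top_iff hK t).symm)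
  rw [h2] at h1
  change genCount n K * _ = genCount n V * _ at h1
  rw [hgen, Nat.card_fun, Nat.card_fun, hcard, Nat.card_eq_fintype_card, Fintype.card_fin] at h1
  have hp0 : (0 : ℝ) < p := by exact_mod_cast hp.out.pos
  have h3 : ((∏ i : Fin n, (p ^ n - p ^ i.val) : ℕ) : ℝ) =
      ((p : ℝ) ^ n) ^ n * ∏ i ∈ Finset.range n, (1 - ((p : ℝ) ^ (i + 1))⁻¹) := by
    rw [Fin.prod_univ_eq_prod_range (fun i => p ^ n - p ^ i) n, Nat.cast_prod,
      ← Finset.prod_range_reflect (fun i => 1 - ((p : ℝ) ^ (i + 1))⁻¹) n]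
    conv_rhs => rw [← Finset.card_range n, ← Finset.prod_const, Finset.card_range,
      ← Finset.prod_mul_distrib]
    refine Finset.prod_congr rfl fun i hi => ?_
    have hi' : i < n := Finset.mem_range.1 hi
    rw [Nat.cast_sub (Nat.pow_le_pow_right hp.out.pos hi'.le)]
    push_cast
    have hsplit : (p : ℝ) ^ n = p ^ i * p ^ (n - i) := by
      rw [← pow_add, Nat.add_sub_cancel' hi'.le]
    rw [mul_sub, mul_one, show n - 1 - i + 1 = n - i by omega]
    congr 1
    rw [hsplit, mul_assoc, mul_inv_cancel₀ (by positivity), mul_one]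
  have h4 : (genCount n K : ℝ) * ((p : ℝ) ^ n) ^ n =
      (((∏ i : Fin n, (p ^ n - p ^ i.val) : ℕ) : ℝ)) * (Nat.card K : ℝ) ^ n := by
    exact_mod_cast h1
  rw [h3] at h4
  have h5 : ((p : ℝ) ^ n) ^ n ≠ 0 := by positivity
  apply mul_right_cancel₀ h5
  rw [h4]
  ring

/-! ### The number of presentations of a finite abelian `p`-group -/

/-- Surjections `M → A` are counted by their kernels and the automorphisms of `A`. -/
theorem card_surjective_hom {M A : Type*} [CommGroup M] [CommGroup A] :
    Nat.card {f : M →* A // Function.Surjective f} =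
      Nat.card {K : Subgroup M // Nonempty (M ⧸ K ≃* A)} * Nat.card (MulAut A) := by
  rw [← Nat.card_prod]
  let e (K : {K : Subgroup M // Nonempty (M ⧸ K ≃* A)}) : M ⧸ K.1 ≃* A := K.2.some
  have hsurj : ∀ K : {K : Subgroup M // Nonempty (M ⧸ K ≃* A)}, Function.Surjective
      ((e K).toMonoidHom.comp (QuotientGroup.mk' K.1)) := fun K =>
    (e K).surjective.comp (QuotientGroup.mk'_surjective K.1)
  have hker : ∀ (K : {K : Subgroup M // Nonempty (M ⧸ K ≃* A)}) (α : MulAut A),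
      (α.toMonoidHom.comp ((e K).toMonoidHom.comp (QuotientGroup.mk' K.1))).ker = K.1 := by
    intro K α
    exact (MonoidHom.ker_mulEquiv_comp _ α).trans
      ((MonoidHom.ker_mulEquiv_comp _ (e K)).trans (QuotientGroup.ker_mk' K.1))
  refine (Nat.card_eq_of_bijective (fun x : {K : Subgroup M // Nonempty (M ⧸ K ≃* A)} × MulAut A =>
    (⟨x.2.toMonoidHom.comp ((e x.1).toMonoidHom.comp (QuotientGroup.mk' x.1.1)),
      x.2.surjective.comp (hsurj x.1)⟩ : {f : M →* A // Function.Surjective f})) ⟨?_, ?_⟩).symm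
  · rintro ⟨K, α⟩ ⟨L, β⟩ h
    have h' := congrArg Subtype.val h
    have hKL : K = L := by
      apply Subtype.ext
      rw [← hker K α, ← hker L β]
      exact congrArg MonoidHom.ker h'
    subst hKL
    refine Prod.ext rfl ?_
    ext a
    obtain ⟨x, rfl⟩ := hsurj K a
    exact DFunLike.congr_fun h' x
  · rintro ⟨f, hf⟩
    let K : {K : Subgroup M // Nonempty (M ⧸ K ≃* A)} :=
      ⟨f.ker, ⟨QuotientGroup.quotientKerEquivOfSurjective f hf⟩⟩
    refine ⟨⟨K, (e K).symm.trans (QuotientGroup.quotientKerEquivOfSurjective f hf)⟩, ?_⟩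
    apply Subtype.ext
    ext x
    change QuotientGroup.quotientKerEquivOfSurjective f hf
      ((e K).symm (e K (QuotientGroup.mk x))) = f x
    rw [MulEquiv.symm_apply_apply]
    rfl

/-- Surjections from a free `ℤ/q`-module are given by generating tuples of the target. -/
theorem card_surjective_hom_pi_zmod {n q : ℕ} [NeZero q] {A : Type*} [CommGroup A]
    (hA : ∀ a : A, a ^ q = 1) :
    Nat.card {f : Multiplicative (Fin n → ZMod q) →* A // Function.Surjective f} =
      genCount n A := by
  let b (i : Fin n) : Multiplicative (Fin n → ZMod q) := Multiplicative.ofAdd (Pi.single i 1)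
  have hb : Subgroup.closure (Set.range b) = ⊤ := closure_range_single_eq_top n q
  have hrange : ∀ f : Multiplicative (Fin n → ZMod q) →* A,
      Function.Surjective f ↔ Subgroup.closure (Set.range fun i => f (b i)) = ⊤ := by
    intro f
    rw [← MonoidHom.range_eq_top, MonoidHom.range_eq_map, ← hb, MonoidHom.map_closure,
      ← Set.range_comp]
    rfl
  refine Nat.card_eq_of_bijective
    (fun f : {f : Multiplicative (Fin n → ZMod q) →* A // Function.Surjective f} =>
      (⟨fun i => f.1 (b i), (hrange f.1).1 f.2⟩ :
        {t : Fin n → A // Subgroup.closure (Set.range t) = ⊤})) ⟨?_, ?_⟩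
  · rintro ⟨f, hf⟩ ⟨g, hg⟩ h
    apply Subtype.ext
    refine MonoidHom.eq_of_eqOn_dense hb ?_
    rintro _ ⟨i, rfl⟩
    exact congrFun (congrArg Subtype.val h) i
  · rintro ⟨t, ht⟩
    obtain ⟨L, hL⟩ := exists_hom_of_pow_eq_one hA t
    have hL' : (fun i => L (b i)) = t := funext hL
    exact ⟨⟨L, (hrange L).2 (hL' ▸ ht)⟩, Subtype.ext hL'⟩

/-- In `M = (ℤ/p^(k+1))^n`, a subgroup `K` with quotient killed by `p^k` contains the `p`-torsion
of `M`, whose order is `p^n`; and `K / pK` has the same order as the `p`-torsion of `K`. -/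
theorem card_quotient_pow_of_quotient {n k : ℕ}
    (K : Subgroup (Multiplicative (Fin n → ZMod (p ^ (k + 1)))))
    (hK : ∀ x, x ^ p ^ k ∈ K) :
    Nat.card (K ⧸ (powMonoidHom p : K →* K).range) = p ^ n := by
  have hp0 : 0 < p := hp.out.pos
  have : NeZero (p ^ (k + 1)) := ⟨pow_ne_zero _ hp0.ne'⟩
  have hmul : p ^ (k + 1) = p * p ^ k := pow_succ' p k
  -- the scalars killed by `p` are the multiples of `p ^ k`
  have htors : ∀ z : ZMod (p ^ (k + 1)), p • z = 0 → ∃ c < p, ((c * p ^ k : ℕ) : ZMod _) = z := by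
    intro z hz
    have h1 : p ^ (k + 1) ∣ p * z.val := by
      rw [← ZMod.natCast_eq_zero_iff, Nat.cast_mul, ZMod.natCast_zmod_val, ← nsmul_eq_mul, hz]
    have h2 : p ^ k ∣ z.val := Nat.dvd_of_mul_dvd_mul_left hp0 (hmul ▸ h1)
    obtain ⟨c, hc⟩ := h2
    refine ⟨c, ?_, ?_⟩
    · have h3 : p ^ k * c < p ^ k * p := by
        rw [← hc, ← pow_succ]
        exact ZMod.val_lt z
      exact Nat.lt_of_mul_lt_mul_left h3
    · rw [mul_comm, ← hc, ZMod.natCast_zmod_val]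
  have hcard1 : Nat.card {z : ZMod (p ^ (k + 1)) // p • z = 0} = p := by
    refine Eq.trans ?_ (Nat.card_fin p)
    refine (Nat.card_eq_of_bijective (fun c : Fin p =>
      (⟨((c.val * p ^ k : ℕ) : ZMod (p ^ (k + 1))), ?_⟩ :
        {z : ZMod (p ^ (k + 1)) // p • z = 0})) ⟨?_, ?_⟩).symm
    · rw [nsmul_eq_mul, ← Nat.cast_mul, ZMod.natCast_eq_zero_iff, hmul]
      exact ⟨c.val, by ring⟩
    · intro c d h
      have h1 := congrArg (fun z => z.1.val) h
      have hlt : ∀ c : Fin p, c.val * p ^ k < p ^ (k + 1) := fun c => by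
        rw [hmul]
        exact Nat.mul_lt_mul_of_pos_right c.2 (pow_pos hp0 k)
      simp only [ZMod.val_natCast_of_lt (hlt _)] at h1
      exact Fin.ext (Nat.eq_of_mul_eq_mul_right (pow_pos hp0 k) h1)
    · rintro ⟨z, hz⟩
      obtain ⟨c, hc, h⟩ := htors z hz
      exact ⟨⟨c, hc⟩, Subtype.ext h⟩
  have hker : Nat.card (powMonoidHom p : K →* K).ker = p ^ n := by
    have hfun : Nat.card (Fin n → {z : ZMod (p ^ (k + 1)) // p • z = 0}) = p ^ n := by
      rw [Nat.card_fun, hcard1, Nat.card_fin]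
    rw [← hfun]
    refine Nat.card_eq_of_bijective (fun x i => ⟨x.1.1.toAdd i, ?_⟩) ⟨?_, ?_⟩
    · have h1 : x.1 ^ p = 1 := x.2
      have h2 : (x.1.1 : Multiplicative (Fin n → ZMod (p ^ (k + 1)))) ^ p = 1 :=
        congrArg Subtype.val h1
      exact congrFun (congrArg Multiplicative.toAdd h2) i
    · intro x y h
      apply Subtype.ext
      apply Subtype.ext
      apply Multiplicative.toAdd.injective
      funext i
      exact congrArg Subtype.val (congrFun h i)
    · intro v
      choose c _ hc using fun i => htors (v i).1 (v i).2
      let w : Multiplicative (Fin n → ZMod (p ^ (k + 1))) :=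
        Multiplicative.ofAdd fun i => (c i : ZMod (p ^ (k + 1)))
      have hw : (w ^ p ^ k).toAdd = fun i => (v i).1 := by
        funext i
        rw [← hc i, mul_comm, Nat.cast_mul, ← nsmul_eq_mul]
        rfl
      refine ⟨⟨⟨w ^ p ^ k, hK w⟩, ?_⟩, ?_⟩
      · rw [MonoidHom.mem_ker]
        apply Subtype.ext
        apply Multiplicative.toAdd.injective
        change p • (w ^ p ^ k).toAdd = 0
        rw [hw]
        funext i
        exact (v i).2
      · funext i
        exact Subtype.ext (congrFun hw i)
  have h1 := Subgroup.card_mul_index (powMonoidHom p : K →* K).ker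
  have h2 := Subgroup.card_mul_index (powMonoidHom p : K →* K).range
  rw [Subgroup.index_ker, hker, ← h2, mul_comm] at h1
  exact (Nat.eq_of_mul_eq_mul_left Nat.card_pos h1).symm

end

section

/-- Tuples are partitioned by the subgroups that they generate. -/
theorem sum_genCount (n : ℕ) {M : Type*} [Group M] [Finite M] (P : Subgroup M → Prop) :
    Nat.card {t : Fin n → M // P (Subgroup.closure (Set.range t))} =
      ∑ᶠ K : {K : Subgroup M // P K}, genCount n K.1 := by
  have := Fintype.ofFinite {K : Subgroup M // P K}
  rw [finsum_eq_sum_of_fintype]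
  let f : {t : Fin n → M // P (Subgroup.closure (Set.range t))} → {K : Subgroup M // P K} :=
    fun t => ⟨Subgroup.closure (Set.range t.1), t.2⟩
  rw [← Nat.card_congr (Equiv.sigmaFiberEquiv f), Nat.card_sigma]
  refine Finset.sum_congr rfl fun K _ => ?_
  rw [← card_closure_eq]
  refine Nat.card_congr
    { toFun := fun t => ⟨t.1.1, congrArg Subtype.val t.2⟩
      invFun := fun t => ⟨⟨t.1, t.2.symm ▸ K.2⟩, Subtype.ext t.2⟩
      left_inv := fun _ => rfl
      right_inv := fun _ => rfl }

/-- A random `n`-tuple in a finite group generates it with probability tending to `1`. -/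
theorem tendsto_genCount_div (A : Type*) [Group A] [Finite A] :
    Tendsto (fun n => (genCount n A : ℝ) / (Nat.card A : ℝ) ^ n) atTop (𝓝 1) := by
  have := Fintype.ofFinite {H : Subgroup A // H ≠ ⊤}
  have hpos : (0 : ℝ) < Nat.card A := by exact_mod_cast Nat.card_pos
  have htotal : ∀ n, (Nat.card A : ℝ) ^ n =
      genCount n A + ∑ H : {H : Subgroup A // H ≠ ⊤}, (genCount n H.1 : ℝ) := by
    intro n
    have h1 := sum_genCount n (M := A) (· ≠ ⊤)
    rw [finsum_eq_sum_of_fintype] at h1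
    have h2 : Nat.card (Fin n → A) = genCount n A +
        Nat.card {t : Fin n → A // Subgroup.closure (Set.range t) ≠ ⊤} := by
      classical
      rw [genCount, ← Nat.card_sum]
      exact Nat.card_congr (Equiv.sumCompl _).symm
    rw [h1, Nat.card_fun, Nat.card_fin] at h2
    exact_mod_cast h2
  have hle : ∀ n (H : Subgroup A), (genCount n H : ℝ) ≤ (Nat.card H : ℝ) ^ n := by
    intro n H
    have : genCount n H ≤ Nat.card (Fin n → H) := Finite.card_subtype_le _
    rw [Nat.card_fun, Nat.card_fin] at this
    exact_mod_cast this
  have hlim : Tendsto (fun n => ∑ H : {H : Subgroup A // H ≠ ⊤},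
      (genCount n H.1 : ℝ) / (Nat.card A : ℝ) ^ n) atTop (𝓝 0) := by
    rw [← Finset.sum_const_zero (s := (Finset.univ : Finset {H : Subgroup A // H ≠ ⊤}))]
    refine tendsto_finsetSum _ fun H _ => ?_
    have hlt : Nat.card H.1 < Nat.card A := by
      refine lt_of_le_of_ne (Subgroup.card_le_card_group H.1) fun h => H.2 ?_
      exact Subgroup.eq_top_of_card_eq _ h
    have h1 : (Nat.card H.1 : ℝ) / Nat.card A < 1 := by
      rw [div_lt_one hpos]
      exact_mod_cast hlt
    refine squeeze_zero (fun n => by positivity) (fun n => ?_)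
      (tendsto_pow_atTop_nhds_zero_of_lt_one (by positivity) h1)
    rw [div_pow]
    gcongr
    exact hle n H.1
  have h := (tendsto_const_nhds (x := (1 : ℝ))).sub hlim
  rw [sub_zero] at h
  refine h.congr fun n => ?_
  have hne : (Nat.card A : ℝ) ^ n ≠ 0 := by positivity
  rw [← Finset.sum_div, eq_div_iff hne, sub_mul, div_mul_cancel₀ _ hne, one_mul, htotal n]
  ring

variable {p : ℕ} [hp : Fact p.Prime]

/-- The number of relation tuples modulo `p ^ (k + 1)` that present `A`. -/
theorem card_presentations {n k : ℕ} {A : Type*} [CommGroup A] [Finite A]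
    (hA : ∀ a : A, a ^ p ^ k = 1) :
    (Nat.card {t : Fin n → Multiplicative (Fin n → ZMod (p ^ (k + 1))) //
      Nonempty (Multiplicative (Fin n → ZMod (p ^ (k + 1))) ⧸ Subgroup.closure (Set.range t) ≃*
        A)} : ℝ) / ((p ^ (k + 1) : ℕ) : ℝ) ^ (n * n) =
      (genCount n A : ℝ) / (Nat.card A : ℝ) ^ n *
        (∏ i ∈ Finset.range n, (1 - ((p : ℝ) ^ (i + 1))⁻¹)) / Nat.card (MulAut A) := by
  have : NeZero (p ^ (k + 1)) := ⟨pow_ne_zero _ hp.out.ne_zero⟩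
  set M := Multiplicative (Fin n → ZMod (p ^ (k + 1))) with hM
  have hMp : IsPGroup p M := isPGroup_multiplicative_pi_zmod ⟨k + 1, rfl⟩
  have hMcard : Nat.card M = (p ^ (k + 1)) ^ n := by simp [hM]
  set g := ∏ i ∈ Finset.range n, (1 - ((p : ℝ) ^ (i + 1))⁻¹)
  have := Fintype.ofFinite {K : Subgroup M // Nonempty (M ⧸ K ≃* A)}
  have hcard : ∀ K : {K : Subgroup M // Nonempty (M ⧸ K ≃* A)},
      (Nat.card M : ℝ) = Nat.card A * Nat.card K.1 := by
    intro K
    obtain ⟨e⟩ := K.2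
    rw [← Subgroup.card_mul_index K.1, ← Nat.card_congr e.toEquiv, mul_comm]
    push_cast
    rfl
  have hA0 : (Nat.card A : ℝ) ≠ 0 := by exact_mod_cast Nat.card_pos.ne'
  have hgen : ∀ K : {K : Subgroup M // Nonempty (M ⧸ K ≃* A)},
      (genCount n K.1 : ℝ) = ((Nat.card M : ℝ) / Nat.card A) ^ n * g := by
    intro K
    obtain ⟨e⟩ := K.2
    have hK : ∀ x, x ^ p ^ k ∈ K.1 := by
      intro x
      rw [← QuotientGroup.eq_one_iff]
      apply e.injective
      rw [QuotientGroup.mk_pow, map_pow, hA, map_one]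
    rw [genCount_of_card_quotient (hMp.to_subgroup K.1) (card_quotient_pow_of_quotient K.1 hK),
      hcard K, mul_div_cancel_left₀ _ hA0]
  have h1 : (Nat.card {t : Fin n → M //
      Nonempty (M ⧸ Subgroup.closure (Set.range t) ≃* A)} : ℝ) =
      Nat.card {K : Subgroup M // Nonempty (M ⧸ K ≃* A)} *
        (((Nat.card M : ℝ) / Nat.card A) ^ n * g) := by
    have h := sum_genCount n (M := M) fun K => Nonempty (M ⧸ K ≃* A)
    rw [finsum_eq_sum_of_fintype] at h
    rw [h]
    push_cast
    rw [Finset.sum_congr rfl fun K _ => hgen K, Finset.sum_const, Finset.card_univ, nsmul_eq_mul,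
      Nat.card_eq_fintype_card (α := {K : Subgroup M // Nonempty (M ⧸ K ≃* A)})]
  have h2 : (genCount n A : ℝ) = Nat.card {K : Subgroup M // Nonempty (M ⧸ K ≃* A)} *
      Nat.card (MulAut A) := by
    have h := card_surjective_hom (M := M) (A := A)
    rw [card_surjective_hom_pi_zmod fun a => by rw [pow_succ, pow_mul, hA, one_pow]] at h
    exact_mod_cast h
  have haut : (Nat.card (MulAut A) : ℝ) ≠ 0 := by
    have : Finite (MulAut A) := Finite.of_injective (fun e : MulAut A => (e : A → A))
      DFunLike.coe_injective
    exact_mod_cast Nat.card_pos.ne'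
  have hM0 : ((p ^ (k + 1) : ℕ) : ℝ) ^ (n * n) = (Nat.card M : ℝ) ^ n := by
    rw [hMcard]
    push_cast
    rw [← pow_mul, ← pow_mul, ← pow_mul]
  have hM1 : (Nat.card M : ℝ) ^ n ≠ 0 := by
    have : (Nat.card M : ℝ) ≠ 0 := by exact_mod_cast Nat.card_pos.ne'
    positivity
  rw [h1, h2, hM0, div_pow]
  field_simp

/-! ### The Cohen–Lenstra measure of the set of groups with given abelianization -/

theorem schMeasure_schAb (h2 : 2 < p) {n k : ℕ} {A : Type*} [CommGroup A] [Finite A]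
    (hA : ∀ a : A, a ^ p ^ k = 1) :
    schMeasure p n (schAb p A) = ENNReal.ofReal ((genCount n A : ℝ) / (Nat.card A : ℝ) ^ n *
        (∏ i ∈ Finset.range n, (1 - ((p : ℝ) ^ (i + 1))⁻¹)) / Nat.card (MulAut A)) := by
  have hq : ∃ j, p ^ (k + 1) = p ^ j := ⟨k + 1, rfl⟩
  let E : Set (Fin n → Multiplicative (Fin n → ZMod (p ^ (k + 1)))) :=
    {t | Nonempty (Multiplicative (Fin n → ZMod (p ^ (k + 1))) ⧸
      Subgroup.closure (Set.range t) ≃* A)}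
  have hpre : Theta p n ⁻¹' schAb p A = {r | (fun i => abMap hq (r i : FreeProP p n)) ∈ E} := by
    ext r
    rw [Set.mem_preimage, Theta_mem_schAb_iff hA, nonempty_mulEquiv_iff_abModPow hA]
    obtain ⟨e⟩ := nonempty_abModPow_mulEquiv hq r
    exact ⟨fun ⟨f⟩ => ⟨e.symm.trans f⟩, fun ⟨f⟩ => ⟨e.trans f⟩⟩
  rw [schMeasure_apply (isClopen_schAb hA).isOpen.measurableSet, hpre, pi_oddHaar_abMap h2 hq,
    ← card_presentations hA]
  have hpos : (0 : ℝ) < ((p ^ (k + 1) : ℕ) : ℝ) ^ (n * n) := by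
    have : 0 < p ^ (k + 1) := pow_pos hp.out.pos _
    positivity
  rw [ENNReal.ofReal_div_of_pos hpos, ENNReal.ofReal_natCast, ENNReal.ofReal_pow (by positivity),
    ENNReal.ofReal_natCast]
  rfl

end

theorem mainTheorem5 (p : ℕ) [Fact p.Prime] (hp : 2 < p)
    (A : Type*) [CommGroup A] [Finite A] (hA : IsPGroup p A) :
    IsSchLimit p (schMeasureInfty p) ∧
      IsClopen (schAb p A) ∧
        schMeasureInfty p (schAb p A) =
          ENNReal.ofReal (cInfty p / (Nat.card (MulAut A) : ℝ)) := by
  obtain ⟨k, hk⟩ := hA.exists_card_eq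
  have hAk : ∀ a : A, a ^ p ^ k = 1 := fun a => by rw [← hk, pow_card_eq_one']
  have hlim := isSchLimit_schMeasureInfty hp
  refine ⟨hlim, isClopen_schAb hAk, ?_⟩
  refine tendsto_nhds_unique (hlim.tendsto _ (isClopen_schAb hAk).isOpen.measurableSet) ?_
  simp only [schMeasure_schAb hp hAk]
  refine ENNReal.tendsto_ofReal (Tendsto.div_const ?_ _)
  simpa using (tendsto_genCount_div A).mul (tendsto_prod_cInfty (p := p) Fact.out)
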